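/- Let $G$ be a finite group acting linearly on a complex vector space $V$ with basis $v_1,\dots,v_n$, and let $\mathbf q=(q_{ij})_{1\le i,j\le n}$ be nonzero complex numbers with $q_{ii}=1$ and $q_{ji}=q_{ij}^{-1}$ for all $i,j$. Put $$S_{\mathbf q}(V)=\mathbb C\langle v_1,\dots,v_n\mid v_iv_j=q_{ij}v_jv_i \text{ for all } i,j\rangle,\qquad \textstyle\bigwedge_{\mathbf q}(V)=\mathbb C\langle v_1,\dots,v_n\mid v_iv_j=-q_{ij}v_jv_i\text{ for all } i,j\rangle .$$ Let $\alpha:G\times G\to\mathbb C^\times$ be a normalized $2$-cocycle, i.e. $\alpha(g_1,g_2)\alpha(g_1g_2,g_3)=\alpha(g_2,g_3)\alpha(g_1,g_2g_3)$ and $\alpha(g,1)=1=\alpha(1,g)$ for all $g,g_1,g_2,g_3\in G$. Suppose that the action of $G$ on $V$ extends to an action by algebra automorphisms on $S_{\mathbf q}(V)$ and on $\bigwedge_{\mathbf q}(V)$. Let $R=S_{\mathbf q}(V)\#_\alpha G$ be the twisted skew group algebra: the vector space $S_{\mathbf q}(V)\otimes\mathbb CG$, with $a\otimes g$ written $at_g$,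 and with multiplication $(at_g)(bt_h)=\alpha(g,h)\,a\,({}^g b)\,t_{gh}$; it is graded with each $v_i$ in degree $1$ and each $t_g$ in degree $0$. A Hochschild $2$-cocycle on $R$ is a $\mathbb C$-bilinear map $\mu:R\times R\to R$ with $a\mu(b,c)+\mu(a,bc)=\mu(ab,c)+\mu(a,b)c$ for all $a,b,c\in R$; it is called constant if it is homogeneous of degree $-2$, i.e. $\mu(R_i,R_j)\subseteq R_{i+j-2}$ for all $i,j\ge 0$, where $R_d=0$ for $d<0$. A deformation of $R$ over $\mathbb C[\hbar]$ is an associative unital $\mathbb C[\hbar]$-algebra with underlying module $R[\hbar]=\mathbb C[\hbar]\otimes R$ that reduces modulo $\hbar$ to $R$; its multiplication is determined by $\mu(a,b)=\sum_{i\ge0}\mu_i(a,b)\hbar^i$ for $a,b\in R$ (a finite sum for each pair $(a,b)$), where the $\mu_i:R\times R\to R$ are $\mathbb C$-bilinear and $\mu_0$ is the multiplication of $R$. Then every constant Hochschild $2$-cocycle $\mu_1'$ on $R$ lifts to a deformation of $R$ over $\mathbb C[\hbar]$; that is, there is a deformation $\mu=\mu_0+\mu_1\hbar+\mu_2\hbar^2+\cdots$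 of $R$ over $\mathbb C[\hbar]$ whose first-order term $\mu_1$ is cohomologous to $\mu_1'$: there is a $\mathbb C$-linear map $f:R\to R$ with $\mu_1'(a,b)-\mu_1(a,b)=af(b)-f(ab)+f(a)b$ for all $a,b\in R$. -/

import Mathlib

open scoped TensorProduct Polynomial

noncomputable section

/-! # Normalized 2-cocycles and twisted skew group algebras -/

/-- A normalized 2-cocycle `α : G × G → kˣ`. -/
structure NormalizedTwoCocycle (k G : Type*) [CommRing k] [Group G] where
  /-- the underlying function -/
  toFun : G → G → kˣ
  cocycle : ∀ g₁ g₂ g₃ : G,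
    toFun g₁ g₂ * toFun (g₁ * g₂) g₃ = toFun g₂ g₃ * toFun g₁ (g₂ * g₃)
  map_one_right : ∀ g : G, toFun g 1 = 1
  map_one_left : ∀ g : G, toFun 1 g = 1

/-- The twisted skew group algebra `A #_α G`, where `G` acts on the `k`-algebra `A` by
automorphisms through `σ`. Its elements are the finite sums `∑ a_g t_g`, represented by the finitely
supported function `g ↦ a_g`; the element `a t_g` is `Finsupp.single g a`. -/
def TwistedSkewGroupAlgebra {k G A : Type*} [CommRing k] [Group G] [Ring A] [Algebra k A]
    (_σ : G →* (A ≃ₐ[k] A)) (_α : NormalizedTwoCocycle k G) : Type _ :=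
  G →₀ A

namespace TwistedSkewGroupAlgebra

variable {k G A : Type*} [CommRing k] [Group G] [Ring A] [Algebra k A]
  {σ : G →* (A ≃ₐ[k] A)} {α : NormalizedTwoCocycle k G}

instance : AddCommGroup (TwistedSkewGroupAlgebra σ α) :=
  inferInstanceAs (AddCommGroup (G →₀ A))

instance : Module k (TwistedSkewGroupAlgebra σ α) :=
  inferInstanceAs (Module k (G →₀ A))

/-- The element `a t_g`. -/
def single (σ : G →* (A ≃ₐ[k] A)) (α : NormalizedTwoCocycle k G) (g : G) (a : A) :
    TwistedSkewGroupAlgebra σ α :=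
  Finsupp.single g a

/-- The coefficient in `A` of `t_g`. -/
def coeff (x : TwistedSkewGroupAlgebra σ α) (g : G) : A :=
  (show G →₀ A from x) g

/-- `(∑ a_g t_g) (∑ b_h t_h) = ∑ α(g,h) a_g (ᵍb_h) t_{gh}`. -/
instance : Mul (TwistedSkewGroupAlgebra σ α) where
  mul x y := Finsupp.sum (show G →₀ A from x) fun g a =>
    Finsupp.sum (show G →₀ A from y) fun h b =>
      single σ α (g * h) ((α.toFun g h : k) • (a * σ g b))

instance : One (TwistedSkewGroupAlgebra σ α) where
  one := single σ α 1 1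

theorem one_def : (1 : TwistedSkewGroupAlgebra σ α) = single σ α 1 1 := rfl

theorem single_zero (g : G) : single σ α g 0 = 0 := Finsupp.single_zero g

theorem single_add (g : G) (a b : A) : single σ α g (a + b) = single σ α g a + single σ α g b :=
  Finsupp.single_add g a b

theorem smul_single (c : k) (g : G) (a : A) : c • single σ α g a = single σ α g (c • a) :=
  Finsupp.smul_single c g a

protected theorem induction {p : TwistedSkewGroupAlgebra σ α → Prop}
    (x : TwistedSkewGroupAlgebra σ α) (zero : p 0) (add : ∀ x y, p x → p y → p (x + y))
    (single : ∀ g a, p (single σ α g a)) : p x :=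
  Finsupp.induction_linear (motive := p) x zero add single

theorem single_mul_single (g h : G) (a b : A) :
    single σ α g a * single σ α h b = single σ α (g * h) ((α.toFun g h : k) • (a * σ g b)) := by
  refine (Finsupp.sum_single_index ?_).trans (Finsupp.sum_single_index ?_)
  · simp [single_zero, Finsupp.sum]
  · simp [single_zero]

protected theorem add_mul' (x y z : TwistedSkewGroupAlgebra σ α) :
    (x + y) * z = x * z + y * z := by
  refine Finsupp.sum_add_index' ?_ ?_
  · intro g; simp [single_zero, Finsupp.sum]
  · intro g a b; simp [add_mul, single_add, Finsupp.sum, Finset.sum_add_distrib]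

protected theorem mul_add' (x y z : TwistedSkewGroupAlgebra σ α) :
    x * (y + z) = x * y + x * z := by
  refine Eq.trans (Finsupp.sum_congr fun g _ => Finsupp.sum_add_index' ?_ ?_) Finsupp.sum_add
  · intro h; simp [single_zero]
  · intro h b c; simp [mul_add, single_add]

protected theorem zero_mul' (x : TwistedSkewGroupAlgebra σ α) : 0 * x = 0 :=
  Finsupp.sum_zero_index

protected theorem mul_zero' (x : TwistedSkewGroupAlgebra σ α) : x * 0 = 0 := by
  have h := TwistedSkewGroupAlgebra.mul_add' x 0 0
  rw [add_zero] at h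
  exact left_eq_add.mp h

protected theorem mul_assoc' (x y z : TwistedSkewGroupAlgebra σ α) :
    x * y * z = x * (y * z) := by
  induction x using TwistedSkewGroupAlgebra.induction with
  | zero => simp only [TwistedSkewGroupAlgebra.zero_mul']
  | add x₁ x₂ h₁ h₂ => simp only [TwistedSkewGroupAlgebra.add_mul', h₁, h₂]
  | single g a =>
  induction y using TwistedSkewGroupAlgebra.induction with
  | zero => simp only [TwistedSkewGroupAlgebra.zero_mul', TwistedSkewGroupAlgebra.mul_zero']
  | add x₁ x₂ h₁ h₂ =>
    simp only [TwistedSkewGroupAlgebra.add_mul', TwistedSkewGroupAlgebra.mul_add', h₁, h₂]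
  | single h b =>
  induction z using TwistedSkewGroupAlgebra.induction with
  | zero => simp only [TwistedSkewGroupAlgebra.mul_zero']
  | add x₁ x₂ h₁ h₂ => simp only [TwistedSkewGroupAlgebra.mul_add', h₁, h₂]
  | single l c =>
    have H := congrArg (Units.val) (α.cocycle g h l)
    simp only [Units.val_mul] at H
    simp only [single_mul_single, mul_assoc, map_mul, map_smul, smul_mul_assoc, mul_smul_comm,
      smul_smul, AlgEquiv.mul_apply]
    rw [mul_comm, H, mul_comm]

protected theorem one_mul' (x : TwistedSkewGroupAlgebra σ α) : 1 * x = x := by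
  induction x using TwistedSkewGroupAlgebra.induction with
  | zero => exact TwistedSkewGroupAlgebra.mul_zero' _
  | add x₁ x₂ h₁ h₂ => rw [TwistedSkewGroupAlgebra.mul_add', h₁, h₂]
  | single g a => simp [one_def, single_mul_single, α.map_one_left]

protected theorem mul_one' (x : TwistedSkewGroupAlgebra σ α) : x * 1 = x := by
  induction x using TwistedSkewGroupAlgebra.induction with
  | zero => exact TwistedSkewGroupAlgebra.zero_mul' _
  | add x₁ x₂ h₁ h₂ => rw [TwistedSkewGroupAlgebra.add_mul', h₁, h₂]
  | single g a => simp [one_def, single_mul_single, α.map_one_right]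

instance : Ring (TwistedSkewGroupAlgebra σ α) :=
  { (inferInstance : AddCommGroup (TwistedSkewGroupAlgebra σ α)) with
    mul := (· * ·)
    one := 1
    mul_assoc := TwistedSkewGroupAlgebra.mul_assoc'
    one_mul := TwistedSkewGroupAlgebra.one_mul'
    mul_one := TwistedSkewGroupAlgebra.mul_one'
    left_distrib := TwistedSkewGroupAlgebra.mul_add'
    right_distrib := TwistedSkewGroupAlgebra.add_mul'
    zero_mul := TwistedSkewGroupAlgebra.zero_mul'
    mul_zero := TwistedSkewGroupAlgebra.mul_zero' }

protected theorem smul_mul' (c : k) (x y : TwistedSkewGroupAlgebra σ α) :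
    (c • x) * y = c • (x * y) := by
  induction x using TwistedSkewGroupAlgebra.induction with
  | zero => rw [smul_zero, zero_mul, smul_zero]
  | add x₁ x₂ h₁ h₂ => rw [smul_add, add_mul, add_mul, smul_add, h₁, h₂]
  | single g a =>
  induction y using TwistedSkewGroupAlgebra.induction with
  | zero => rw [mul_zero, mul_zero, smul_zero]
  | add x₁ x₂ h₁ h₂ => rw [mul_add, mul_add, smul_add, h₁, h₂]
  | single h b =>
    simp only [smul_single, single_mul_single, smul_mul_assoc]
    rw [smul_comm]

protected theorem mul_smul' (c : k) (x y : TwistedSkewGroupAlgebra σ α) :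
    x * (c • y) = c • (x * y) := by
  induction x using TwistedSkewGroupAlgebra.induction with
  | zero => rw [zero_mul, zero_mul, smul_zero]
  | add x₁ x₂ h₁ h₂ => rw [add_mul, add_mul, smul_add, h₁, h₂]
  | single g a =>
  induction y using TwistedSkewGroupAlgebra.induction with
  | zero => rw [smul_zero, mul_zero, smul_zero]
  | add x₁ x₂ h₁ h₂ => rw [smul_add, mul_add, mul_add, smul_add, h₁, h₂]
  | single h b =>
    simp only [smul_single, single_mul_single, map_smul, mul_smul_comm]
    rw [smul_comm]

instance : Algebra k (TwistedSkewGroupAlgebra σ α) :=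
  Algebra.ofModule TwistedSkewGroupAlgebra.smul_mul' TwistedSkewGroupAlgebra.mul_smul'

/-- For a family `𝒜` of homogeneous components of `A`, the component of degree `d` of `A #_α G`,
where every `t_g` has degree `0`: the sums `∑ a_g t_g` with all `a_g ∈ 𝒜 d`. -/
def degreePart (σ : G →* (A ≃ₐ[k] A)) (α : NormalizedTwoCocycle k G) (𝒜 : ℕ → Submodule k A)
    (d : ℕ) : Submodule k (TwistedSkewGroupAlgebra σ α) where
  carrier := {x | ∀ g, x.coeff g ∈ 𝒜 d}
  add_mem' hx hy g := (𝒜 d).add_mem (hx g) (hy g)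
  zero_mem' _ := (𝒜 d).zero_mem
  smul_mem' c _ hx g := (𝒜 d).smul_mem c (hx g)

end TwistedSkewGroupAlgebra

/-! # Quantum symmetric and quantum exterior algebras -/

/-- The relations `v_i v_j = c_{ij} v_j v_i` in the tensor algebra of the free module `V` with basis
`v`. -/
inductive QuadraticRel {k V : Type*} [CommRing k] [AddCommGroup V] [Module k V] {n : ℕ}
    (v : Module.Basis (Fin n) k V) (c : Fin n → Fin n → k) :
    TensorAlgebra k V → TensorAlgebra k V → Prop
  | rel (i j : Fin n) : QuadraticRel v c
      (TensorAlgebra.ι k (v i) * TensorAlgebra.ι k (v j))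
      (c i j • (TensorAlgebra.ι k (v j) * TensorAlgebra.ι k (v i)))

/-- The algebra `k⟨v_1, …, v_n ∣ v_i v_j = c_{ij} v_j v_i⟩`, as a quotient of the tensor algebra
of `V`. -/
abbrev QuadraticAlg {k V : Type*} [CommRing k] [AddCommGroup V] [Module k V] {n : ℕ}
    (v : Module.Basis (Fin n) k V) (c : Fin n → Fin n → k) : Type _ :=
  RingQuot (QuadraticRel v c)

namespace QuadraticAlg

variable {k V : Type*} [CommRing k] [AddCommGroup V] [Module k V] {n : ℕ}

/-- The canonical linear map from `V`. -/
def ι (v : Module.Basis (Fin n) k V) (c : Fin n → Fin n → k) : V →ₗ[k] QuadraticAlg v c :=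
  (RingQuot.mkAlgHom k (QuadraticRel v c)).toLinearMap ∘ₗ TensorAlgebra.ι k

/-- The component of degree `d`, where the vectors of `V` have degree `1`: the span of the products
of `d` vectors of `V`. -/
def degreePart (v : Module.Basis (Fin n) k V) (c : Fin n → Fin n → k) (d : ℕ) :
    Submodule k (QuadraticAlg v c) :=
  LinearMap.range (ι v c) ^ d

/-- The action `τ` of `G` by algebra automorphisms extends the linear action `ρ` of `G` on `V`. -/
def Extends {G : Type*} [Group G] (ρ : Representation k G V) {v : Module.Basis (Fin n) k V}
    {c : Fin n → Fin n → k} (τ : G →* (QuadraticAlg v c ≃ₐ[k] QuadraticAlg v c)) : Prop :=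
  ∀ (g : G) (w : V), τ g (ι v c w) = ι v c (ρ g w)

end QuadraticAlg

/-- The quantum symmetric algebra `S_q(V)`: relations `v_i v_j = q_{ij} v_j v_i`. -/
abbrev QuantumSymmetricAlgebra {k V : Type*} [CommRing k] [AddCommGroup V] [Module k V] {n : ℕ}
    (v : Module.Basis (Fin n) k V) (q : Fin n → Fin n → k) : Type _ :=
  QuadraticAlg v q

/-- The quantum exterior algebra `⋀_q(V)`: relations `v_i v_j = -q_{ij} v_j v_i`. -/
abbrev QuantumExteriorAlgebra {k V : Type*} [CommRing k] [AddCommGroup V] [Module k V] {n : ℕ}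
    (v : Module.Basis (Fin n) k V) (q : Fin n → Fin n → k) : Type _ :=
  QuadraticAlg v (fun i j => -q i j)

/-! # Hochschild 2-cocycles -/

section Hochschild

variable {k R : Type*} [CommRing k] [Ring R] [Algebra k R]

/-- The Hochschild 2-cocycle condition. -/
def IsHochschildTwoCocycle (μ : R →ₗ[k] R →ₗ[k] R) : Prop :=
  ∀ a b c : R, a * μ b c + μ a (b * c) = μ (a * b) c + μ a b * c

/-- Two 2-cochains are cohomologous if they differ by the coboundary of a 1-cochain. -/
def HochschildCohomologous (μ ν : R →ₗ[k] R →ₗ[k] R) : Prop :=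
  ∃ f : R →ₗ[k] R, ∀ a b : R, μ a b - ν a b = a * f b - f (a * b) + f a * b

/-- A 2-cochain on a graded algebra, with components `𝓡 d` for `d : ℕ` (and zero components in
negative degrees), has degree `-2`. -/
def HasDegreeNegTwo (𝓡 : ℕ → Submodule k R) (μ : R →ₗ[k] R →ₗ[k] R) : Prop :=
  ∀ (i j : ℕ) (a b : R), a ∈ 𝓡 i → b ∈ 𝓡 j →
    (i + j < 2 → μ a b = 0) ∧ ∀ d : ℕ, i + j = d + 2 → μ a b ∈ 𝓡 d

end Hochschild

/-! # Deformations over `k[ħ]` -/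

/-- The coefficient of `ħ ^ i` of an element of `R[ħ] = k[ħ] ⊗ R`. -/
def hbarCoeff (k R : Type*) [CommRing k] [Ring R] [Algebra k R] (i : ℕ) :
    k[X] ⊗[k] R →ₗ[k] R :=
  (TensorProduct.lid k R).toLinearMap ∘ₗ (Polynomial.lcoeff k i).rTensor R

/-- A deformation of `R` over `k[ħ]`: an associative unital `k[ħ]`-algebra structure on
`R[ħ] = k[ħ] ⊗ R` which reduces modulo `ħ` to the multiplication of `R`. -/
structure PolynomialDeformation (k R : Type*) [CommRing k] [Ring R] [Algebra k R] where
  /-- the `k[ħ]`-bilinear multiplication -/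
  mul : (k[X] ⊗[k] R) →ₗ[k[X]] (k[X] ⊗[k] R) →ₗ[k[X]] (k[X] ⊗[k] R)
  mul_assoc : ∀ x y z, mul (mul x y) z = mul x (mul y z)
  exists_one : ∃ e, ∀ x, mul e x = x ∧ mul x e = x
  reduction : ∀ x y, hbarCoeff k R 0 (mul x y) = hbarCoeff k R 0 x * hbarCoeff k R 0 y

/-- The bilinear map `μ_i : R × R → R` in `μ(a, b) = ∑ μ_i(a, b) ħ ^ i` for `a, b ∈ R`. -/
def PolynomialDeformation.term {k R : Type*} [CommRing k] [Ring R] [Algebra k R]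
    (D : PolynomialDeformation k R) (i : ℕ) : R →ₗ[k] R →ₗ[k] R :=
  LinearMap.mk₂ k (fun a b => hbarCoeff k R i (D.mul (1 ⊗ₜ a) (1 ⊗ₜ b)))
    (fun a a' b => by simp [TensorProduct.tmul_add])
    (fun c a b => by
      simp only [← TensorProduct.smul_tmul, ← TensorProduct.smul_tmul']
      rw [← algebraMap_smul k[X] c, map_smul, LinearMap.smul_apply, algebraMap_smul, map_smul])
    (fun a b b' => by simp [TensorProduct.tmul_add])
    (fun c a b => by
      simp only [← TensorProduct.smul_tmul, ← TensorProduct.smul_tmul']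
      rw [← algebraMap_smul k[X] c, map_smul, algebraMap_smul, map_smul])

end

/-! # Lifting constant Hochschild 2-cocycles on `S_q(V) #_α G` -/

noncomputable section

/-! The deformation is built from the values κ_ij = μ(v_i, v_j) - q_ij μ(v_j, v_i) on the quadratic
relators. They have degree 0, so they lie in the span of the t_g. Take the algebra generated by T(V)
#_α G and a central ħ with the relations v_i v_j - q_ij v_j v_i = ħ κ_ij. It must be shown that this
algebra is R[ħ] as a k[ħ]-module (a PBW property), and that its first-order term is μ up to a
coboundary.

PBW property. The ordered words times the t_g span, by induction on length
(`DeformedAlg.ofSection_surjective`). For independence it suffices to have a k[ħ]-linear map from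
(T(V) #_α G)[ħ] to R[ħ] which respects the deformed relations and is the projection modulo ħ
(`exists_isCompatible`). On words of length d the relations prescribe, after division by a product
of q's, the difference of the values across each adjacent transposition. Such a prescription can be
integrated once it is consistent around squares (two disjoint transpositions) and hexagons (three
consecutive letters): `InsertionSort.exists_potential`. Squares are consistent by the compatibility
already achieved in length d - 2. Hexagons are consistent by an identity linear in κ, a q-weighted
alternating sum of six instances of the cocycle identity (`relatorValue_hexagon`). As κ has degree
0, no condition quadratic in κ arises. The group is handled by equivariance of κ
(`single_mul_relatorValue`). All these identities live in degrees 0 and 1, where T(V) #_α G and R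
agree, so they lift from R.

First-order term. On R × R = R ⊕ Rε act the left multiplications of the square-zero extension with
product ab + ε μ(a, b). Constancy makes μ vanish on pairs formed from the t_g, or from a t_g and a
vector, so T(V) #_α G acts there, with each relator acting as ε κ_ij. Letting ħ act as ε gives an
action of the deformed algebra, and the ε-part of a product compares μ with the first-order term
(`exists_deformation`). -/

/-! ### Additive maps on ring quotients -/

/-- An additive map constant along all two-sided multiples of the relations descends to the
quotient. This allows test maps that are not multiplicative. Keeping both multipliers universally
quantified is what carries the induction through products. -/
theorem RingQuot.map_eq_of_mkAlgHom_eq {k A W : Type*} [CommRing k] [Ring A] [Algebra k A]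
    [AddCommGroup W] (r : A → A → Prop) (p : A →+ W)
    (h : ∀ a b x y, r x y → p (a * x * b) = p (a * y * b)) {x y : A}
    (hxy : RingQuot.mkAlgHom k r x = RingQuot.mkAlgHom k r y) : p x = p y := by
  have hK : ∀ {u u' : A}, RingQuot.Rel r u u' → ∀ a b, p (a * u * b) = p (a * u' * b) := by
    intro u u' huu
    induction huu with
    | of h' => exact fun a b => h a b _ _ h'
    | add_left _ ih => intro a b; simp only [mul_add, add_mul, map_add, ih]
    | mul_left _ ih => intro a b; simpa only [mul_assoc] using ih a (_ * b)
    | mul_right _ ih => intro a b; simpa only [mul_assoc] using ih (a * _) b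
  have h1 : Relation.EqvGen (RingQuot.Rel r) x y := by
    have h2 : RingQuot.mkRingHom r x = RingQuot.mkRingHom r y := by
      rw [← RingQuot.mkAlgHom_coe k r]
      exact hxy
    rw [RingQuot.mkRingHom_def] at h2
    exact Quot.eqvGen_exact (congrArg RingQuot.toQuot h2)
  have h3 : ∀ a b, p (a * x * b) = p (a * y * b) := by
    clear hxy
    induction h1 with
    | rel _ _ h => exact hK h
    | refl _ => exact fun _ _ => rfl
    | symm _ _ _ ih => exact fun a b => (ih a b).symm
    | trans _ _ _ _ _ ih1 ih2 => exact fun a b => (ih1 a b).trans (ih2 a b)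
  simpa using h3 1 1

/-! ### Integrating a function on adjacent transpositions of words -/

theorem insertionSort_swap {I : Type*} [LinearOrder I] (x : List I) (i j : I) (y : List I) :
    (x ++ i :: j :: y).insertionSort (· ≤ ·) = (x ++ j :: i :: y).insertionSort (· ≤ ·) :=
  ((List.perm_insertionSort _ _).trans (((List.Perm.swap _ _ _).append_left x).trans
    (List.perm_insertionSort _ _).symm)).eq_of_pairwise' (List.pairwise_insertionSort _ _)
    (List.pairwise_insertionSort _ _)

namespace InsertionSort

section Potential

variable {I W : Type*} [LinearOrder I] [AddCommGroup W] (φ : List I → I → I → List I → W)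

/-- The sum of `φ` along the path of adjacent transpositions which moves `i` from the position
after the prefix `x` to its place in the list `u`. -/
def insertPath : List I → I → List I → W
  | _, _, [] => 0
  | x, i, k :: u => if i ≤ k then 0 else φ x i k u + insertPath (x ++ [k]) i u

/-- The sum of `φ` along the insertion sort of the part of a word after the prefix `x`. -/
def sortPath : List I → List I → W
  | _, [] => 0
  | x, i :: w => sortPath (x ++ [i]) w + insertPath φ x i (w.insertionSort (· ≤ ·))

variable {φ}

/-- Each step of the insertion is disjoint from the swap of i and j in the prefix, so a square
relation carries the swap past it. The differences telescope. -/
theorem insertPath_sub_insertPath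
    (hsq : ∀ x i j y k l z, φ x i j (y ++ k :: l :: z) + φ (x ++ j :: i :: y) k l z =
      φ (x ++ i :: j :: y) k l z + φ x i j (y ++ l :: k :: z))
    (x : List I) (i j : I) (y : List I) (k : I) (u : List I) :
    insertPath φ (x ++ i :: j :: y) k u - insertPath φ (x ++ j :: i :: y) k u =
      φ x i j (y ++ k :: u) - φ x i j (y ++ u.orderedInsert (· ≤ ·) k) := by
  induction u generalizing y with
  | nil => simp [insertPath]
  | cons l u ih =>
    by_cases h : k ≤ l
    · simp [insertPath, h]
    · have h1 := ih (y ++ [l])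
      have h2 := hsq x i j y k l u
      simp only [insertPath, h, if_false, List.orderedInsert_cons, List.append_assoc,
        List.cons_append, List.nil_append] at h1 h2 ⊢
      linear_combination (norm := abel) h1 - h2

/-- The same telescoping over a whole sort: only the swap seen before and after sorting the tail
survives. -/
theorem sortPath_sub_sortPath
    (hsq : ∀ x i j y k l z, φ x i j (y ++ k :: l :: z) + φ (x ++ j :: i :: y) k l z =
      φ (x ++ i :: j :: y) k l z + φ x i j (y ++ l :: k :: z))
    (x : List I) (i j : I) (y u : List I) :
    sortPath φ (x ++ i :: j :: y) u - sortPath φ (x ++ j :: i :: y) u =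
      φ x i j (y ++ u) - φ x i j (y ++ u.insertionSort (· ≤ ·)) := by
  induction u generalizing y with
  | nil => simp [sortPath]
  | cons k u ih =>
    have h1 := ih (y ++ [k])
    have h2 := insertPath_sub_insertPath hsq x i j y k (u.insertionSort (· ≤ ·))
    simp only [sortPath, List.insertionSort_cons, List.append_assoc,
      List.cons_append, List.nil_append] at h1 h2 ⊢
    linear_combination (norm := abel) h1 + h2

/-- The two orders of inserting i and j give two paths to the same word. If at most one letter
passes the head of u, the paths differ by the single edge i, j. If both pass it, one hexagon and two
squares reduce the claim to the tail of u. -/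
theorem insertPath_hexagon
    (hanti : ∀ x i j y, φ x i j y = - φ x j i y) (hdiag : ∀ x i y, φ x i i y = 0)
    (hsq : ∀ x i j y k l z, φ x i j (y ++ k :: l :: z) + φ (x ++ j :: i :: y) k l z =
      φ (x ++ i :: j :: y) k l z + φ x i j (y ++ l :: k :: z))
    (hhex : ∀ x i j k y,
      φ x i j (k :: y) + φ (x ++ [j]) i k y + φ x j k (i :: y) =
      φ (x ++ [i]) j k y + φ x i k (j :: y) + φ (x ++ [k]) i j y)
    (x : List I) (i j : I) (u : List I) :
    insertPath φ (x ++ [i]) j u + insertPath φ x i (u.orderedInsert (· ≤ ·) j) -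
      (insertPath φ (x ++ [j]) i u + insertPath φ x j (u.orderedInsert (· ≤ ·) i)) =
      φ x i j u := by
  induction u generalizing x i j with
  | nil =>
    rcases lt_trichotomy i j with h | rfl | h
    · simp [insertPath, h.le, h.not_ge, hanti x j i]
    · simp [insertPath, hdiag]
    · simp [insertPath, h.le, h.not_ge]
  | cons k u ih =>
    rcases eq_or_ne i j with rfl | hij
    · simp [hdiag]
    by_cases hi : i ≤ k <;> by_cases hj : j ≤ k
    · rcases lt_or_gt_of_ne hij with h | h
      · simp [insertPath, hi, hj, h.le, h.not_ge, hanti x j i]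
      · simp [insertPath, hi, hj, h.le, h.not_ge]
    · have h : i ≤ j := hi.trans (not_le.mp hj).le
      have h' : ¬ j ≤ i := fun h' => hj (h'.trans hi)
      simp [insertPath, hi, hj, h', hanti x j i]
    · have h' : ¬ i ≤ j := fun h' => hi (h'.trans hj)
      simp [insertPath, hi, hj, h']
    · have h1 := ih (x ++ [k]) i j
      have h2 := insertPath_sub_insertPath hsq x i k [] j u
      have h3 := insertPath_sub_insertPath hsq x j k [] i u
      have h4 := hhex x i j k u
      simp only [insertPath, hi, hj, if_false, List.orderedInsert_cons, List.append_assoc,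
        List.cons_append, List.nil_append] at h1 h2 h3 h4 ⊢
      linear_combination (norm := abel) h1 + h2 - h3 - h4

/-- A function on the adjacent transpositions of words which is compatible with the
relations between them is the difference of a function on words. -/
theorem exists_potential
    (hanti : ∀ x i j y, φ x i j y = - φ x j i y) (hdiag : ∀ x i y, φ x i i y = 0)
    (hsq : ∀ x i j y k l z, φ x i j (y ++ k :: l :: z) + φ (x ++ j :: i :: y) k l z =
      φ (x ++ i :: j :: y) k l z + φ x i j (y ++ l :: k :: z))
    (hhex : ∀ x i j k y,
      φ x i j (k :: y) + φ (x ++ [j]) i k y + φ x j k (i :: y) =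
      φ (x ++ [i]) j k y + φ x i k (j :: y) + φ (x ++ [k]) i j y) :
    ∃ L : List I → W, ∀ x i j y, L (x ++ i :: j :: y) - L (x ++ j :: i :: y) = φ x i j y := by
  -- The potential sums φ along the insertion sort of the word. The prefix z is generalized because
  -- the recursion moves letters into it. The letters of x before the swap are inserted into equal
  -- sorted lists, so their contributions cancel.
  suffices H : ∀ z x i j y, sortPath φ z (x ++ i :: j :: y) - sortPath φ z (x ++ j :: i :: y) =
      φ (z ++ x) i j y from ⟨sortPath φ [], fun x i j y => by simpa using H [] x i j y⟩
  intro z x i j y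
  induction x generalizing z with
  | nil =>
    have h1 := insertPath_hexagon hanti hdiag hsq hhex z i j (y.insertionSort (· ≤ ·))
    have h2 := sortPath_sub_sortPath hsq z i j [] y
    simp only [sortPath, List.insertionSort_cons, List.append_assoc, List.append_nil,
      List.cons_append, List.nil_append] at h1 h2 ⊢
    linear_combination (norm := abel) h1 + h2
  | cons k x ih =>
    have h1 := ih (z ++ [k])
    simp only [sortPath, insertionSort_swap x i j y, List.append_assoc, List.cons_append,
      List.nil_append] at h1 ⊢
    linear_combination (norm := abel) h1

end Potential
end InsertionSort

/-- The conditions on the scalars `q i j` in the definition of a quantum symmetric algebra. -/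
structure IsQuantumSystem {k : Type*} [Field k] {n : ℕ} (q : Fin n → Fin n → k) : Prop where
  ne_zero : ∀ i j, q i j ≠ 0
  diag : ∀ i, q i i = 1
  inv : ∀ i j, q j i = (q i j)⁻¹

/-! ### The scalar acquired by sorting a word -/

section InvWeight

variable {k : Type*} [Field k] {n : ℕ}

theorem IsQuantumSystem.mul_swap {q : Fin n → Fin n → k} (hq : IsQuantumSystem q) (i j : Fin n) :
    q i j * q j i = 1 := by
  rw [hq.inv i j, mul_inv_cancel₀ (hq.ne_zero i j)]

/-- The product of the `q i j` over the inversions of a word. -/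
def invWeight (q : Fin n → Fin n → k) : List (Fin n) → k
  | [] => 1
  | i :: w => (w.map fun j => if j < i then q i j else 1).prod * invWeight q w

theorem invWeight_ne_zero {q : Fin n → Fin n → k} (hq : IsQuantumSystem q) (w : List (Fin n)) :
    invWeight q w ≠ 0 := by
  induction w with
  | nil => exact one_ne_zero
  | cons i w ih =>
    refine mul_ne_zero (List.prod_ne_zero ?_) ih
    simp only [List.mem_map, not_exists, not_and]
    intro j _
    split_ifs
    · exact hq.ne_zero i j
    · exact one_ne_zero

/-- Only the pair at the two swapped positions can change status. If i < j the inversion is on the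
right, and q_ij q_ji = 1 absorbs it. If i = j the factor is q_ii = 1. -/
theorem invWeight_swap {q : Fin n → Fin n → k} (hq : IsQuantumSystem q) (x : List (Fin n))
    (i j : Fin n) (y : List (Fin n)) :
    invWeight q (x ++ i :: j :: y) = q i j * invWeight q (x ++ j :: i :: y) := by
  induction x with
  | nil =>
    have h := hq.mul_swap i j
    simp only [List.nil_append, invWeight, List.map_cons, List.prod_cons]
    rcases lt_trichotomy i j with hij | rfl | hij
    · simp only [hij, hij.not_gt, if_true, if_false]
      linear_combination (-(List.map (fun j_1 ↦ if j_1 < i then q i j_1 else 1) y).prod *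
        (List.map (fun j_1 ↦ if j_1 < j then q j j_1 else 1) y).prod * invWeight q y) * h
    · simp [hq.diag]
    · simp only [hij, hij.not_gt, if_true, if_false]
      ring
  | cons l x ih =>
    simp only [List.cons_append, invWeight, ih, List.map_append, List.map_cons, List.prod_append,
      List.prod_cons]
    ring

theorem invWeight_eq_one_of_pairwise (q : Fin n → Fin n → k) {w : List (Fin n)}
    (h : w.Pairwise (· ≤ ·)) : invWeight q w = 1 := by
  induction w with
  | nil => rfl
  | cons i w ih =>
    rw [List.pairwise_cons] at h
    rw [invWeight, ih h.2, mul_one]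
    refine List.prod_eq_one fun a ha => ?_
    obtain ⟨j, hj, rfl⟩ := List.mem_map.mp ha
    rw [if_neg (h.1 j hj).not_gt]

/-- A function on words which is compatible with the relations `v_i v_j = q_{ij} v_j v_i` is
determined by its values on ordered words. -/
theorem eq_invWeight_smul_insertionSort {M : Type*} [AddCommGroup M] [Module k M]
    {q : Fin n → Fin n → k} (hq : IsQuantumSystem q) {f : List (Fin n) → M}
    (hf : ∀ x i j y, f (x ++ i :: j :: y) = q i j • f (x ++ j :: i :: y)) (w : List (Fin n)) :
    f w = invWeight q w • f (w.insertionSort (· ≤ ·)) := by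
  -- Cross-multiplied, so that the claim is symmetric and passes through the generators of
  -- `List.Perm`. Transitivity cancels the nonzero weight of the middle word.
  have key : ∀ {u w : List (Fin n)}, u.Perm w → ∀ x,
      invWeight q (x ++ w) • f (x ++ u) = invWeight q (x ++ u) • f (x ++ w) := by
    intro u w h
    induction h with
    | nil => exact fun _ => rfl
    | cons i _ ih => intro x; simpa using ih (x ++ [i])
    | swap i j y =>
      intro x
      rw [invWeight_swap hq x j i, hf x j i, smul_smul, mul_comm]
    | @trans a b c _ _ ih1 ih2 =>
      intro x
      apply smul_right_injective M (invWeight_ne_zero hq (x ++ b))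
      simp only
      rw [smul_comm, ih1 x, smul_comm, ih2 x, smul_comm]
  have h := key (List.perm_insertionSort (· ≤ ·) w) []
  simp only [List.nil_append, invWeight_eq_one_of_pairwise q
    (List.pairwise_insertionSort (· ≤ ·) w), one_smul] at h
  exact h.symm

end InvWeight

/-! ### Words, relators and normal ordering in T(V) -/

section Words

variable {k V : Type*} [Field k] [AddCommGroup V] [Module k V] {n : ℕ}
  (v : Module.Basis (Fin n) k V)

/-- The product of basis vectors given by a word. -/
def word (w : List (Fin n)) : TensorAlgebra k V := (w.map fun i => TensorAlgebra.ι k (v i)).prod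

theorem word_nil : word v [] = 1 := rfl

theorem word_cons (i : Fin n) (w : List (Fin n)) :
    word v (i :: w) = TensorAlgebra.ι k (v i) * word v w := by
  simp [word]

theorem word_append (w w' : List (Fin n)) : word v (w ++ w') = word v w * word v w' := by
  simp [word]

/-- The words form a basis of the tensor algebra. -/
def wordBasis : Module.Basis (List (Fin n)) k (TensorAlgebra k V) :=
  v.tensorAlgebra.reindex FreeMonoid.toList

theorem wordBasis_apply (w : List (Fin n)) : wordBasis v w = word v w := by
  rw [wordBasis, Module.Basis.reindex_apply]
  have h : FreeAlgebra.basisFreeMonoid k (Fin n) (FreeMonoid.toList.symm w) =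
      (w.map (FreeAlgebra.ι k)).prod := by
    have h1 : FreeAlgebra.basisFreeMonoid k (Fin n) (FreeMonoid.toList.symm w) =
      MonoidAlgebra.lift k (FreeAlgebra k (Fin n)) (FreeMonoid (Fin n))
        (FreeMonoid.lift (FreeAlgebra.ι k))
        (MonoidAlgebra.single (FreeMonoid.toList.symm w) 1) := rfl
    rw [h1, MonoidAlgebra.lift_single, one_smul, FreeMonoid.lift_apply]
    rfl
  rw [Module.Basis.tensorAlgebra, Module.Basis.map_apply, h, AlgEquiv.toLinearEquiv_apply,
    map_list_prod, List.map_map, word]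
  congr 2
  funext i
  simp

/-- The linear extension of a function on words. -/
def wordLift {M : Type*} [AddCommGroup M] [Module k M] (f : List (Fin n) → M) :
    TensorAlgebra k V →ₗ[k] M :=
  (wordBasis v).constr k f

theorem wordLift_word {M : Type*} [AddCommGroup M] [Module k M] (f : List (Fin n) → M)
    (w : List (Fin n)) : wordLift v f (word v w) = f w := by
  rw [wordLift, ← wordBasis_apply, Module.Basis.constr_basis]

theorem linearMap_ext_word {M : Type*} [AddCommGroup M] [Module k M]
    {f g : TensorAlgebra k V →ₗ[k] M} (h : ∀ w, f (word v w) = g (word v w)) : f = g :=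
  (wordBasis v).ext fun w => by rw [wordBasis_apply, h]

/-- The quadratic relator `v_i v_j - q_{ij} v_j v_i`. -/
def relator (q : Fin n → Fin n → k) (i j : Fin n) : TensorAlgebra k V :=
  TensorAlgebra.ι k (v i) * TensorAlgebra.ι k (v j) -
    q i j • (TensorAlgebra.ι k (v j) * TensorAlgebra.ι k (v i))

variable (q : Fin n → Fin n → k)

theorem word_mul_relator_mul_word (x : List (Fin n)) (i j : Fin n) (y : List (Fin n)) :
    word v x * relator v q i j * word v y =
      word v (x ++ i :: j :: y) - q i j • word v (x ++ j :: i :: y) := by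
  simp only [relator, word_append, word_cons, mul_sub, sub_mul, mul_smul_comm, smul_mul_assoc,
    mul_assoc]

/-- The projection from the tensor algebra. -/
def QuadraticAlg.proj : TensorAlgebra k V →ₐ[k] QuadraticAlg v q :=
  RingQuot.mkAlgHom k (QuadraticRel v q)

theorem QuadraticAlg.proj_surjective : Function.Surjective (QuadraticAlg.proj v q) :=
  RingQuot.mkAlgHom_surjective k _

theorem QuadraticAlg.proj_ι (x : V) :
    QuadraticAlg.proj v q (TensorAlgebra.ι k x) = QuadraticAlg.ι v q x := rfl

theorem QuadraticAlg.proj_relator (i j : Fin n) :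
    QuadraticAlg.proj v q (relator v q i j) = 0 := by
  rw [relator, map_sub, sub_eq_zero]
  exact RingQuot.mkAlgHom_rel k (QuadraticRel.rel i j)

theorem QuadraticAlg.proj_word_swap (x : List (Fin n)) (i j : Fin n) (y : List (Fin n)) :
    QuadraticAlg.proj v q (word v (x ++ i :: j :: y)) =
      q i j • QuadraticAlg.proj v q (word v (x ++ j :: i :: y)) := by
  rw [← sub_eq_zero, ← map_smul, ← map_sub, ← word_mul_relator_mul_word, map_mul, map_mul,
    QuadraticAlg.proj_relator, mul_zero, zero_mul]

theorem wordLift_mul_relator_mul {M : Type*} [AddCommGroup M] [Module k M]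
    {f : List (Fin n) → M}
    (hf : ∀ x i j y, f (x ++ i :: j :: y) = q i j • f (x ++ j :: i :: y))
    (a b : TensorAlgebra k V) (i j : Fin n) : wordLift v f (a * relator v q i j * b) = 0 := by
  have h : (LinearMap.mul k _).compr₂ (wordLift v f) ∘ₗ LinearMap.mulRight k (relator v q i j) =
      0 := by
    refine linearMap_ext_word v fun x => linearMap_ext_word v fun y => ?_
    simp only [LinearMap.comp_apply, LinearMap.compr₂_apply, LinearMap.mulRight_apply,
      LinearMap.mul_apply', word_mul_relator_mul_word, map_sub, map_smul, wordLift_word,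
      LinearMap.zero_apply]
    rw [hf x i j y, sub_self]
  exact LinearMap.congr_fun (LinearMap.congr_fun h a) b

theorem wordLift_eq_of_proj_eq {M : Type*} [AddCommGroup M] [Module k M]
    {f : List (Fin n) → M}
    (hf : ∀ x i j y, f (x ++ i :: j :: y) = q i j • f (x ++ j :: i :: y))
    {a b : TensorAlgebra k V} (h : QuadraticAlg.proj v q a = QuadraticAlg.proj v q b) :
    wordLift v f a = wordLift v f b := by
  refine RingQuot.map_eq_of_mkAlgHom_eq (k := k) (QuadraticRel v q)
    (wordLift v f).toAddMonoidHom ?_ h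
  rintro a b _ _ ⟨i, j⟩
  have := wordLift_mul_relator_mul v q hf a b i j
  rw [relator, mul_sub, sub_mul, map_sub, sub_eq_zero] at this
  exact this

/-- The linear map which sorts words, with the sign-like factors `q i j`. -/
def normalOrder : TensorAlgebra k V →ₗ[k] TensorAlgebra k V :=
  wordLift v fun w => invWeight q w • word v (w.insertionSort (· ≤ ·))

variable {q}

theorem normalOrder_eq_of_proj_eq (hq : IsQuantumSystem q) {a b : TensorAlgebra k V}
    (h : QuadraticAlg.proj v q a = QuadraticAlg.proj v q b) :
    normalOrder v q a = normalOrder v q b := by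
  refine wordLift_eq_of_proj_eq v q (fun x i j y => ?_) h
  rw [invWeight_swap hq, insertionSort_swap, smul_smul]

theorem proj_normalOrder (hq : IsQuantumSystem q) (a : TensorAlgebra k V) :
    QuadraticAlg.proj v q (normalOrder v q a) = QuadraticAlg.proj v q a := by
  suffices h : (QuadraticAlg.proj v q).toLinearMap ∘ₗ normalOrder v q =
      (QuadraticAlg.proj v q).toLinearMap from LinearMap.congr_fun h a
  refine linearMap_ext_word v fun w => ?_
  simp only [LinearMap.comp_apply, normalOrder, wordLift_word, AlgHom.toLinearMap_apply, map_smul]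
  exact (eq_invWeight_smul_insertionSort hq
    (f := fun w => QuadraticAlg.proj v q (word v w)) (QuadraticAlg.proj_word_swap v q) w).symm

/-- The quantum symmetric algebra embeds into the tensor algebra by ordered words. -/
theorem exists_section (hq : IsQuantumSystem q) :
    ∃ s : QuadraticAlg v q →ₗ[k] TensorAlgebra k V,
      (∀ a, QuadraticAlg.proj v q (s a) = a) ∧
      ∀ x, s (QuadraticAlg.proj v q x) = normalOrder v q x := by
  obtain ⟨g, hg⟩ := (QuadraticAlg.proj v q).toLinearMap.exists_rightInverse_of_surjective
    (LinearMap.range_eq_top.mpr (QuadraticAlg.proj_surjective v q))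
  have hg' : ∀ a, QuadraticAlg.proj v q (g a) = a := fun a => LinearMap.congr_fun hg a
  refine ⟨normalOrder v q ∘ₗ g, fun a => ?_, fun x => ?_⟩
  · rw [LinearMap.comp_apply, proj_normalOrder v hq, hg']
  · exact normalOrder_eq_of_proj_eq v hq (hg' _)

/-- Words of length at most one are already ordered, so normal ordering fixes them, while it depends
only on the class in S_q(V). -/
theorem proj_algebraMap_add_ι_injective (hq : IsQuantumSystem q) {c : k} {x : V}
    (h : QuadraticAlg.proj v q (algebraMap k _ c + TensorAlgebra.ι k x) = 0) :
    algebraMap k (TensorAlgebra k V) c + TensorAlgebra.ι k x = 0 := by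
  have h1 : normalOrder v q (algebraMap k _ c + TensorAlgebra.ι k x) = normalOrder v q 0 :=
    normalOrder_eq_of_proj_eq v hq (by rw [h, map_zero])
  have h2 : normalOrder v q (algebraMap k _ c) = algebraMap k _ c := by
    rw [Algebra.algebraMap_eq_smul_one, map_smul, ← word_nil v, normalOrder, wordLift_word]
    simp [invWeight]
  have h3 : normalOrder v q ∘ₗ TensorAlgebra.ι k = TensorAlgebra.ι k := by
    refine v.ext fun i => ?_
    have : TensorAlgebra.ι k (v i) = word v [i] := by simp [word]
    rw [LinearMap.comp_apply, this, normalOrder, wordLift_word]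
    simp [invWeight]
  rw [map_add, h2, map_zero, ← LinearMap.comp_apply, h3] at h1
  exact h1

/-- The coefficients of a quadratic element of the ideal of relations are `q`-antisymmetric. -/
theorem coeff_antisymm_of_proj_eq_zero (hq : IsQuantumSystem q) (a : Fin n → Fin n → k)
    (h : QuadraticAlg.proj v q
      (∑ i, ∑ j, a i j • (TensorAlgebra.ι k (v i) * TensorAlgebra.ι k (v j))) = 0)
    (i j : Fin n) : a i j + q j i * a j i = 0 := by
  -- A functional on words of length two with β_ab = q_ab β_ba, so that it kills the relators. Its
  -- value on the given element is a_ij + q_ji a_ji.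
  let β : Fin n → Fin n → k := fun i' j' =>
    (if i' = i ∧ j' = j then 1 else 0) + q i' j' * (if j' = i ∧ i' = j then 1 else 0)
  let f : List (Fin n) → k := fun w => match w with
    | [i', j'] => β i' j'
    | _ => 0
  have hf : ∀ x i j y, f (x ++ i :: j :: y) = q i j • f (x ++ j :: i :: y) := by
    intro x i' j' y
    rcases x with _ | ⟨a, _ | ⟨b, _ | ⟨c, x⟩⟩⟩
    · rcases y with _ | ⟨_, _⟩
      · have h := hq.mul_swap i' j'
        simp only [List.nil_append, f, β, smul_eq_mul, mul_add, ← mul_assoc, h, one_mul]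
        rw [add_comm]
      · simp [f]
    · simp [f]
    · simp [f]
    · simp [f]
  have h1 := wordLift_eq_of_proj_eq v q hf (h.trans (map_zero _).symm)
  have h2 : ∀ i j, TensorAlgebra.ι k (v i) * TensorAlgebra.ι k (v j) = word v [i, j] := by
    simp [word]
  simp only [h2, map_sum, map_smul, wordLift_word, map_zero] at h1
  simp only [f, β, smul_eq_mul, mul_add, Finset.sum_add_distrib] at h1
  rw [← h1]
  congr 1
  · simp [ite_and]
  · rw [Finset.sum_comm]
    simp [ite_and, mul_comm]

/-- Writes a q-antisymmetric combination through relators. The sum over all ordered pairs meets each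
relator twice, up to a scalar, hence the factor 1/2. -/
theorem sum_smul_eq_sum_half_smul_sub {M : Type*} [AddCommGroup M] [Module k M]
    (h2 : (2 : k) ≠ 0) {a : Fin n → Fin n → k} (ha : ∀ i j, a i j + q j i * a j i = 0)
    (u : Fin n → Fin n → M) :
    ∑ i, ∑ j, a i j • u i j = ∑ i, ∑ j, (2⁻¹ * a i j) • (u i j - q i j • u j i) := by
  have h : ∑ i, ∑ j, (2⁻¹ * a i j) • q i j • u j i = - ∑ i, ∑ j, (2⁻¹ * a i j) • u i j := by
    rw [Finset.sum_comm]
    simp only [← Finset.sum_neg_distrib, ← neg_smul, smul_smul]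
    refine Finset.sum_congr rfl fun i _ => Finset.sum_congr rfl fun j _ => ?_
    congr 1
    linear_combination (2⁻¹ : k) * ha i j
  simp only [smul_sub, Finset.sum_sub_distrib, h, sub_neg_eq_add, ← two_smul k]
  simp only [Finset.smul_sum, smul_smul, mul_inv_cancel_left₀ h2]

end Words

/-! ### Linear maps and the universal property of A #_α G -/

namespace TwistedSkewGroupAlgebra

section General

variable {k G A : Type*} [CommRing k] [Group G] [Ring A] [Algebra k A]
  {σ : G →* (A ≃ₐ[k] A)} {α : NormalizedTwoCocycle k G}

/-- The map `a ↦ a t_g`. -/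
def lsingle (σ : G →* (A ≃ₐ[k] A)) (α : NormalizedTwoCocycle k G) (g : G) :
    A →ₗ[k] TwistedSkewGroupAlgebra σ α where
  toFun := single σ α g
  map_add' := single_add g
  map_smul' c a := (smul_single c g a).symm

theorem lsingle_apply (g : G) (a : A) : lsingle σ α g a = single σ α g a := rfl

/-- The inclusion of `A` into `A #_α G`. -/
def ofCoeff (σ : G →* (A ≃ₐ[k] A)) (α : NormalizedTwoCocycle k G) :
    A →ₐ[k] TwistedSkewGroupAlgebra σ α :=
  AlgHom.ofLinearMap (lsingle σ α 1) rfl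
    fun a b => by simp [lsingle_apply, single_mul_single, α.map_one_left]

theorem ofCoeff_apply (a : A) : ofCoeff σ α a = single σ α 1 a := rfl

/-- The linear map given by its restrictions to the subspaces `A t_g`. -/
def linearLift {M : Type*} [AddCommGroup M] [Module k M] (φ : G → A →ₗ[k] M) :
    TwistedSkewGroupAlgebra σ α →ₗ[k] M :=
  Finsupp.lsum k φ

theorem linearLift_single {M : Type*} [AddCommGroup M] [Module k M] (φ : G → A →ₗ[k] M)
    (g : G) (a : A) : linearLift φ (single σ α g a) = φ g a :=
  (Finsupp.lsum_apply k φ _).trans (Finsupp.sum_single_index (map_zero _))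

theorem linearMap_ext {M : Type*} [AddCommGroup M] [Module k M]
    {f f' : TwistedSkewGroupAlgebra σ α →ₗ[k] M}
    (h : ∀ g a, f (single σ α g a) = f' (single σ α g a)) : f = f' :=
  LinearMap.ext fun x => by
    induction x using TwistedSkewGroupAlgebra.induction with
    | zero => simp
    | add x y hx hy => simp [hx, hy]
    | single g a => exact h g a

theorem coeff_single [DecidableEq G] (g h : G) (a : A) :
    (single σ α g a).coeff h = if g = h then a else 0 :=
  Finsupp.single_apply

theorem coeff_add (x y : TwistedSkewGroupAlgebra σ α) (g : G) :
    (x + y).coeff g = x.coeff g + y.coeff g := rfl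

theorem coeff_zero (g : G) : (0 : TwistedSkewGroupAlgebra σ α).coeff g = 0 := rfl

theorem coeff_smul (c : k) (x : TwistedSkewGroupAlgebra σ α) (g : G) :
    (c • x).coeff g = c • x.coeff g := rfl

theorem ext_coeff {x y : TwistedSkewGroupAlgebra σ α} (h : ∀ g, x.coeff g = y.coeff g) : x = y :=
  Finsupp.ext h

theorem single_one_mul_single (a b : A) (h : G) :
    single σ α 1 a * single σ α h b = single σ α h (a * b) := by
  simp [single_mul_single, α.map_one_left]

theorem single_mul_single_one (g : G) (a : A) (h : G) :
    single σ α g a * single σ α h 1 = single σ α (g * h) ((α.toFun g h : k) • a) := by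
  simp [single_mul_single]

theorem single_mul_single_right (g : G) (b : A) :
    single σ α g 1 * single σ α 1 b = single σ α 1 (σ g b) * single σ α g 1 := by
  simp [single_mul_single, α.map_one_left, α.map_one_right]

theorem single_one_mul_single_one (a : A) (g : G) :
    single σ α 1 a * single σ α g 1 = single σ α g a := by
  simp [single_one_mul_single]

variable {B : Type*} [Ring B] [Algebra k B]

/-- The universal property of the twisted skew group algebra. -/
def lift (f : A →ₐ[k] B) (u : G → B) (hu_one : u 1 = 1)
    (hu_mul : ∀ g h, u g * u h = (α.toFun g h : k) • u (g * h))
    (hu : ∀ g a, u g * f a = f (σ g a) * u g) : TwistedSkewGroupAlgebra σ α →ₐ[k] B :=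
  AlgHom.ofLinearMap (linearLift fun g => LinearMap.mulRight k (u g) ∘ₗ f.toLinearMap)
    (by simp [one_def, linearLift_single, hu_one])
    (by
      intro x y
      induction x using TwistedSkewGroupAlgebra.induction with
      | zero => simp
      | add x x' hx hx' => simp only [add_mul, map_add, hx, hx']
      | single g a =>
      induction y using TwistedSkewGroupAlgebra.induction with
      | zero => simp
      | add x x' hx hx' => simp only [mul_add, map_add, hx, hx']
      | single h b =>
      simp only [single_mul_single, linearLift_single, LinearMap.comp_apply,
        AlgHom.toLinearMap_apply, LinearMap.mulRight_apply, map_smul, map_mul]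
      rw [← mul_smul_comm, ← hu_mul, mul_assoc (f a) (u g), ← mul_assoc (u g) (f b), hu]
      simp only [mul_assoc])

theorem lift_single (f : A →ₐ[k] B) (u : G → B) (hu_one : u 1 = 1)
    (hu_mul : ∀ g h, u g * u h = (α.toFun g h : k) • u (g * h))
    (hu : ∀ g a, u g * f a = f (σ g a) * u g) (g : G) (a : A) :
    lift f u hu_one hu_mul hu (single σ α g a) = f a * u g :=
  linearLift_single _ g a

end General

end TwistedSkewGroupAlgebra

/-! ### The group action on T(V) and the projection T(V) #_α G → S_q(V) #_α G -/

section TensorAction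

variable {k G V : Type*} [CommRing k] [Group G] [AddCommGroup V] [Module k V]

/-- The action of `G` on the tensor algebra extending a linear action on `V`. -/
def tensorAction (ρ : Representation k G V) :
    G →* (TensorAlgebra k V ≃ₐ[k] TensorAlgebra k V) where
  toFun g := AlgEquiv.ofAlgHom (TensorAlgebra.lift k (TensorAlgebra.ι k ∘ₗ ρ g))
    (TensorAlgebra.lift k (TensorAlgebra.ι k ∘ₗ ρ g⁻¹))
    (TensorAlgebra.hom_ext (LinearMap.ext fun x => by simp [← Module.End.mul_apply, ← map_mul]))
    (TensorAlgebra.hom_ext (LinearMap.ext fun x => by simp [← Module.End.mul_apply, ← map_mul]))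
  map_one' := by
    apply AlgEquiv.coe_toAlgHom_injective
    exact TensorAlgebra.hom_ext (LinearMap.ext fun x => by simp)
  map_mul' g h := by
    apply AlgEquiv.coe_toAlgHom_injective
    exact TensorAlgebra.hom_ext (LinearMap.ext fun x => by simp)

theorem tensorAction_ι (ρ : Representation k G V) (g : G) (x : V) :
    tensorAction ρ g (TensorAlgebra.ι k x) = TensorAlgebra.ι k (ρ g x) := by
  simp [tensorAction]

end TensorAction

section SkewProj

variable {k G V : Type*} [Field k] [Group G] [AddCommGroup V] [Module k V] {n : ℕ}
  {v : Module.Basis (Fin n) k V} {q : Fin n → Fin n → k} {ρ : Representation k G V}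
  {α : NormalizedTwoCocycle k G} {σ : G →* (QuadraticAlg v q ≃ₐ[k] QuadraticAlg v q)}

open TwistedSkewGroupAlgebra

theorem QuadraticAlg.Extends.proj_tensorAction (hσ : QuadraticAlg.Extends ρ σ) (g : G)
    (x : TensorAlgebra k V) :
    QuadraticAlg.proj v q (tensorAction ρ g x) = σ g (QuadraticAlg.proj v q x) := by
  have h : (QuadraticAlg.proj v q).comp (tensorAction ρ g : TensorAlgebra k V →ₐ[k] _) =
      (σ g : QuadraticAlg v q →ₐ[k] _).comp (QuadraticAlg.proj v q) := by
    refine TensorAlgebra.hom_ext (LinearMap.ext fun x => ?_)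
    simp only [LinearMap.comp_apply, AlgHom.toLinearMap_apply, AlgHom.comp_apply,
      AlgEquiv.coe_toAlgHom, tensorAction_ι, QuadraticAlg.proj_ι, hσ g x]
  exact DFunLike.congr_fun h x

/-- The projection `T(V) #_α G → S_q(V) #_α G`. -/
def skewProj (hσ : QuadraticAlg.Extends ρ σ) (α : NormalizedTwoCocycle k G) :
    TwistedSkewGroupAlgebra (tensorAction ρ) α →ₐ[k] TwistedSkewGroupAlgebra σ α :=
  TwistedSkewGroupAlgebra.lift
    ((ofCoeff σ α).comp (QuadraticAlg.proj v q))
    (fun g => single σ α g 1) rfl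
    (fun g h => by simp [single_mul_single, smul_single])
    (fun g a => by
      simp only [AlgHom.comp_apply, ofCoeff_apply,
        single_mul_single_right, hσ.proj_tensorAction])

theorem skewProj_single (hσ : QuadraticAlg.Extends ρ σ) (g : G) (x : TensorAlgebra k V) :
    skewProj hσ α (single _ α g x) = single σ α g (QuadraticAlg.proj v q x) :=
  (lift_single _ _ _ _ _ g x).trans (single_one_mul_single_one _ g)

/-- The component of degree `d` of `T(V) #_α G`. -/
def wordDegree (v : Module.Basis (Fin n) k V) (ρ : Representation k G V)
    (α : NormalizedTwoCocycle k G) (d : ℕ) :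
    Submodule k (TwistedSkewGroupAlgebra (tensorAction ρ) α) :=
  Submodule.span k {X | ∃ w g, w.length = d ∧ X = single _ α g (word v w)}

theorem single_word_mem_wordDegree (w : List (Fin n)) (g : G) :
    single _ α g (word v w) ∈ wordDegree v ρ α w.length :=
  Submodule.subset_span ⟨w, g, rfl, rfl⟩

theorem single_one_mem_wordDegree (g : G) : single _ α g 1 ∈ wordDegree v ρ α 0 :=
  single_word_mem_wordDegree [] g

theorem tensorAction_word_mem_span (w : List (Fin n)) (g : G) :
    tensorAction ρ g (word v w) ∈
      Submodule.span k (word v '' {w' : List (Fin n) | w'.length = w.length}) := by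
  induction w with
  | nil =>
    rw [word_nil, map_one]
    exact Submodule.subset_span ⟨[], rfl, rfl⟩
  | cons i w ih =>
    rw [word_cons, map_mul, tensorAction_ι, ← v.sum_repr (ρ g (v i)), map_sum, Finset.sum_mul]
    refine Submodule.sum_mem _ fun j _ => ?_
    rw [map_smul, smul_mul_assoc]
    refine Submodule.smul_mem _ _ ?_
    refine Submodule.span_induction (p := fun x _ => TensorAlgebra.ι k (v j) * x ∈ _) ?_ ?_ ?_ ?_ ih
    · rintro _ ⟨w', hw', rfl⟩
      refine Submodule.subset_span ⟨j :: w', ?_, word_cons v j w'⟩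
      have : w'.length = w.length := hw'
      simp [this]
    · simp
    · intro x y _ _ hx hy
      rw [mul_add]
      exact Submodule.add_mem _ hx hy
    · intro c x _ hx
      rw [mul_smul_comm]
      exact Submodule.smul_mem _ _ hx

theorem mul_mem_wordDegree {a b : ℕ} {X Y : TwistedSkewGroupAlgebra (tensorAction ρ) α}
    (hX : X ∈ wordDegree v ρ α a) (hY : Y ∈ wordDegree v ρ α b) :
    X * Y ∈ wordDegree v ρ α (a + b) := by
  induction hX using Submodule.span_induction with
  | zero => simp
  | add X X' _ _ h h' => rw [add_mul]; exact Submodule.add_mem _ h h'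
  | smul c X _ h => rw [smul_mul_assoc]; exact Submodule.smul_mem _ _ h
  | mem X hX =>
  obtain ⟨x, g, rfl, rfl⟩ := hX
  induction hY using Submodule.span_induction with
  | zero => simp
  | add X X' _ _ h h' => rw [mul_add]; exact Submodule.add_mem _ h h'
  | smul c X _ h => rw [mul_smul_comm]; exact Submodule.smul_mem _ _ h
  | mem Y hY =>
  obtain ⟨y, h, rfl, rfl⟩ := hY
  rw [single_mul_single, ← smul_single]
  refine Submodule.smul_mem _ _ ?_
  refine Submodule.span_induction (p := fun z _ => single _ α (g * h) (word v x * z) ∈ _)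
    ?_ ?_ ?_ ?_ (tensorAction_word_mem_span (v := v) (ρ := ρ) y g)
  · rintro _ ⟨w', hw', rfl⟩
    have : w'.length = y.length := hw'
    refine Submodule.subset_span ⟨x ++ w', g * h, by simp [this], by rw [word_append]⟩
  · simp [single_zero]
  · intro x y _ _ hx hy
    rw [mul_add, single_add]
    exact Submodule.add_mem _ hx hy
  · intro c x _ hx
    rw [mul_smul_comm, ← smul_single]
    exact Submodule.smul_mem _ _ hx

/-- In degrees at most one, the projection `T(V) #_α G → S_q(V) #_α G` is injective. -/
theorem eq_of_skewProj_eq (hq : IsQuantumSystem q) (hσ : QuadraticAlg.Extends ρ σ) {d : ℕ}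
    (hd : d ≤ 1) {X Y : TwistedSkewGroupAlgebra (tensorAction ρ) α}
    (hX : X ∈ wordDegree v ρ α d) (hY : Y ∈ wordDegree v ρ α d)
    (h : skewProj hσ α X = skewProj hσ α Y) : X = Y := by
  classical
  have hlow : ∀ Z ∈ wordDegree v ρ α d, ∀ g, ∃ c x,
      Z.coeff g = algebraMap k (TensorAlgebra k V) c + TensorAlgebra.ι k x := by
    intro Z hZ g
    induction hZ using Submodule.span_induction with
    | zero => exact ⟨0, 0, by simp [coeff_zero]⟩
    | add Z Z' _ _ h h' =>
      obtain ⟨c, x, h⟩ := h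
      obtain ⟨c', x', h'⟩ := h'
      exact ⟨c + c', x + x', by rw [coeff_add, h, h', map_add, map_add]; abel⟩
    | smul a Z _ h =>
      obtain ⟨c, x, h⟩ := h
      exact ⟨a * c, a • x, by
        rw [coeff_smul, h, map_smul, map_mul, smul_add, Algebra.smul_def a (algebraMap k _ c)]⟩
    | mem Z hZ =>
      obtain ⟨w, g', hw, rfl⟩ := hZ
      rw [coeff_single]
      split_ifs
      · rcases w with _ | ⟨i, _ | ⟨j, w⟩⟩
        · exact ⟨1, 0, by simp [word]⟩
        · exact ⟨0, v i, by simp [word]⟩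
        · simp at hw; omega
      · exact ⟨0, 0, by simp⟩
  have hcoeff : ∀ (Z : TwistedSkewGroupAlgebra (tensorAction ρ) α) g,
      (skewProj hσ α Z).coeff g = QuadraticAlg.proj v q (Z.coeff g) := by
    intro Z g
    induction Z using TwistedSkewGroupAlgebra.induction with
    | zero => simp [coeff_zero]
    | add Z Z' h h' => rw [map_add, coeff_add, coeff_add, map_add, h, h']
    | single g' x =>
      rw [skewProj_single, coeff_single, coeff_single]
      split_ifs <;> simp
  rw [← sub_eq_zero]
  refine ext_coeff fun g => ?_
  have h1 : skewProj hσ α (X - Y) = 0 := by rw [map_sub, h, sub_self]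
  obtain ⟨c, x, hc⟩ := hlow _ (Submodule.sub_mem _ hX hY) g
  have h2 := hcoeff (X - Y) g
  rw [h1, coeff_zero, hc] at h2
  rw [hc, coeff_zero]
  exact proj_algebraMap_add_ι_injective v hq h2.symm

variable (ρ α) in
/-- The linear map on skew group algebras induced by a section of `T(V) → S_q(V)`. -/
def skewSection (σ : G →* (QuadraticAlg v q ≃ₐ[k] QuadraticAlg v q))
    (s : QuadraticAlg v q →ₗ[k] TensorAlgebra k V) :
    TwistedSkewGroupAlgebra σ α →ₗ[k] TwistedSkewGroupAlgebra (tensorAction ρ) α :=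
  linearLift fun g => lsingle _ α g ∘ₗ s

theorem skewSection_single (s : QuadraticAlg v q →ₗ[k] TensorAlgebra k V) (g : G)
    (a : QuadraticAlg v q) :
    skewSection ρ α σ s (single σ α g a) = single _ α g (s a) :=
  linearLift_single _ g a

theorem skewProj_skewSection (hσ : QuadraticAlg.Extends ρ σ)
    {s : QuadraticAlg v q →ₗ[k] TensorAlgebra k V} (hs : ∀ a, QuadraticAlg.proj v q (s a) = a)
    (x : TwistedSkewGroupAlgebra σ α) : skewProj hσ α (skewSection ρ α σ s x) = x := by
  induction x using TwistedSkewGroupAlgebra.induction with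
  | zero => simp
  | add x y hx hy => rw [map_add, map_add, hx, hy]
  | single g a => rw [skewSection_single, skewProj_single, hs]

theorem skewSection_mem_wordDegree_zero {s : QuadraticAlg v q →ₗ[k] TensorAlgebra k V}
    (hs : ∀ x, s (QuadraticAlg.proj v q x) = normalOrder v q x)
    {x : TwistedSkewGroupAlgebra σ α}
    (hx : x ∈ degreePart σ α (QuadraticAlg.degreePart v q) 0) :
    skewSection ρ α σ s x ∈ wordDegree v ρ α 0 := by
  have h1 : ∀ a ∈ QuadraticAlg.degreePart v q 0, ∀ g : G,
      single (tensorAction ρ) α g (s a) ∈ wordDegree v ρ α 0 := by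
    intro a ha g
    rw [QuadraticAlg.degreePart, pow_zero, Submodule.mem_one] at ha
    obtain ⟨c, rfl⟩ := ha
    have h2 : s (algebraMap k _ c) = c • 1 := by
      rw [← AlgHom.commutes (QuadraticAlg.proj v q), hs, Algebra.algebraMap_eq_smul_one, map_smul,
        ← word_nil v, normalOrder, wordLift_word]
      simp [invWeight]
    rw [h2, ← smul_single]
    exact Submodule.smul_mem _ _ (single_one_mem_wordDegree g)
  have h2 : skewSection ρ α σ s x = Finsupp.sum (show G →₀ _ from x)
      fun g a => single (tensorAction ρ) α g (s a) := Finsupp.lsum_apply k _ _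
  rw [h2]
  exact Submodule.sum_mem _ fun g _ => h1 _ (hx g) g

end SkewProj

/-! ### The square-zero extension defined by a cocycle -/

section SquareZero

variable {k R : Type*} [CommRing k] [Ring R] [Algebra k R]

/-- The operator `(a, b) ↦ (r a, r b + μ(r, a))`. -/
def squareZeroMul (μ : R →ₗ[k] R →ₗ[k] R) : R →ₗ[k] Module.End k (R × R) :=
  LinearMap.mk₂ k (fun r p => (r * p.1, r * p.2 + μ r p.1))
    (fun r r' p => by
      ext
      · simp [add_mul]
      · simp only [add_mul, map_add, LinearMap.add_apply, Prod.snd_add]; abel)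
    (fun c r p => by ext <;> simp [smul_add])
    (fun r p p' => by
      ext
      · simp [mul_add]
      · simp only [mul_add, map_add, Prod.snd_add, Prod.fst_add]; abel)
    (fun c r p => by ext <;> simp [smul_add])

variable (k) in
/-- The operator `(a, b) ↦ (0, r a)`. -/
def squareZeroIncl : R →ₗ[k] Module.End k (R × R) :=
  LinearMap.mk₂ k (fun r p => (0, r * p.1))
    (fun r r' p => by simp [add_mul])
    (fun c r p => by simp)
    (fun r p p' => by simp [mul_add])
    (fun c r p => by simp)

theorem squareZeroMul_apply (μ : R →ₗ[k] R →ₗ[k] R) (r a b : R) :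
    squareZeroMul μ r (a, b) = (r * a, r * b + μ r a) := rfl

theorem squareZeroIncl_apply (r a b : R) :
    squareZeroIncl k r (a, b) = (0, r * a) := rfl

/-- This is the cocycle identity at (r, r', a). The two operators are left multiplications by r and
by rε in R ⊕ Rε with product twisted by μ. -/
theorem squareZeroMul_mul_squareZeroMul {μ : R →ₗ[k] R →ₗ[k] R} (hμ : IsHochschildTwoCocycle μ)
    (r r' : R) : squareZeroMul μ r * squareZeroMul μ r' =
      squareZeroMul μ (r * r') + squareZeroIncl k (μ r r') := by
  refine LinearMap.ext fun ⟨a, b⟩ => ?_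
  simp only [Module.End.mul_apply, LinearMap.add_apply, squareZeroMul_apply, squareZeroIncl_apply,
    Prod.mk_add_mk, add_zero, mul_assoc, Prod.mk.injEq, true_and, mul_add]
  linear_combination (norm := abel) hμ r r' a

theorem squareZeroMul_mul_squareZeroIncl (μ : R →ₗ[k] R →ₗ[k] R) (r r' : R) :
    squareZeroMul μ r * squareZeroIncl k r' = squareZeroIncl k (r * r') := by
  refine LinearMap.ext fun ⟨a, b⟩ => ?_
  simp [squareZeroMul_apply, squareZeroIncl_apply, mul_assoc]

theorem squareZeroIncl_mul_squareZeroMul (μ : R →ₗ[k] R →ₗ[k] R) (r r' : R) :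
    squareZeroIncl k r * squareZeroMul μ r' = squareZeroIncl k (r * r') := by
  refine LinearMap.ext fun ⟨a, b⟩ => ?_
  simp [squareZeroMul_apply, squareZeroIncl_apply, mul_assoc]

theorem squareZeroIncl_mul_squareZeroIncl (r r' : R) :
    squareZeroIncl k r * squareZeroIncl k r' = 0 := by
  refine LinearMap.ext fun ⟨a, b⟩ => ?_
  simp [squareZeroIncl_apply]

theorem IsHochschildTwoCocycle.one_left {μ : R →ₗ[k] R →ₗ[k] R} (hμ : IsHochschildTwoCocycle μ)
    (h : μ 1 1 = 0) (c : R) : μ 1 c = 0 := by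
  simpa [h] using hμ 1 1 c

theorem IsHochschildTwoCocycle.one_right {μ : R →ₗ[k] R →ₗ[k] R} (hμ : IsHochschildTwoCocycle μ)
    (h : μ 1 1 = 0) (c : R) : μ c 1 = 0 := by
  simpa [h] using hμ c 1 1

theorem squareZeroMul_one {μ : R →ₗ[k] R →ₗ[k] R} (hμ : IsHochschildTwoCocycle μ)
    (h : μ 1 1 = 0) : squareZeroMul μ 1 = 1 := by
  refine LinearMap.ext fun ⟨a, b⟩ => ?_
  simp [squareZeroMul_apply, hμ.one_left h]

end SquareZero

/-! ### Values of a constant cocycle on the quadratic relators -/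

section ConstantCocycle

variable {k G V : Type*} [Field k] [Group G] [AddCommGroup V] [Module k V] {n : ℕ}
  {v : Module.Basis (Fin n) k V} {q : Fin n → Fin n → k} {ρ : Representation k G V}
  {α : NormalizedTwoCocycle k G} {σ : G →* (QuadraticAlg v q ≃ₐ[k] QuadraticAlg v q)}

open TwistedSkewGroupAlgebra

/-- The inclusion of `V` into `S_q(V) #_α G`. -/
def skewVec (σ : G →* (QuadraticAlg v q ≃ₐ[k] QuadraticAlg v q)) (α : NormalizedTwoCocycle k G) :
    V →ₗ[k] TwistedSkewGroupAlgebra σ α :=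
  lsingle σ α 1 ∘ₗ QuadraticAlg.ι v q

theorem skewVec_mul_swap (i j : Fin n) : skewVec σ α (v i) * skewVec σ α (v j) =
    q i j • (skewVec σ α (v j) * skewVec σ α (v i)) := by
  have h := QuadraticAlg.proj_relator v q i j
  simp only [relator, map_sub, map_smul, map_mul, QuadraticAlg.proj_ι, sub_eq_zero] at h
  simp only [skewVec, LinearMap.comp_apply, lsingle_apply, single_one_mul_single, smul_single, h]

theorem single_one_mul_skewVec (hσ : QuadraticAlg.Extends ρ σ) (g : G) (x : V) :
    single σ α g 1 * skewVec σ α x = skewVec σ α (ρ g x) * single σ α g 1 := by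
  simp only [skewVec, LinearMap.comp_apply, lsingle_apply, single_mul_single_right, hσ g x]

theorem single_one_mem_degreePart (g : G) :
    single σ α g 1 ∈ degreePart σ α (QuadraticAlg.degreePart v q) 0 := by
  classical
  intro h
  rw [coeff_single, QuadraticAlg.degreePart, pow_zero]
  split_ifs
  · exact Submodule.one_le.mp le_rfl
  · exact Submodule.zero_mem _

theorem skewVec_mem_degreePart (x : V) :
    skewVec σ α x ∈ degreePart σ α (QuadraticAlg.degreePart v q) 1 := by
  classical
  intro h
  rw [skewVec, LinearMap.comp_apply, lsingle_apply, coeff_single, QuadraticAlg.degreePart, pow_one]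
  split_ifs
  · exact ⟨x, rfl⟩
  · exact Submodule.zero_mem _

variable {μ : TwistedSkewGroupAlgebra σ α →ₗ[k] TwistedSkewGroupAlgebra σ α →ₗ[k]
  TwistedSkewGroupAlgebra σ α}

section Degree

variable (hc : HasDegreeNegTwo (degreePart σ α (QuadraticAlg.degreePart v q)) μ)

include hc

theorem HasDegreeNegTwo.single_single (g h : G) : μ (single σ α g 1) (single σ α h 1) = 0 :=
  (hc 0 0 _ _ (single_one_mem_degreePart g) (single_one_mem_degreePart h)).1 (by norm_num)

theorem HasDegreeNegTwo.single_skewVec (g : G) (x : V) :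
    μ (single σ α g 1) (skewVec σ α x) = 0 :=
  (hc 0 1 _ _ (single_one_mem_degreePart g) (skewVec_mem_degreePart x)).1 (by norm_num)

theorem HasDegreeNegTwo.skewVec_single (g : G) (x : V) :
    μ (skewVec σ α x) (single σ α g 1) = 0 :=
  (hc 1 0 _ _ (skewVec_mem_degreePart x) (single_one_mem_degreePart g)).1 (by norm_num)

theorem HasDegreeNegTwo.skewVec_skewVec_mem (x y : V) :
    μ (skewVec σ α x) (skewVec σ α y) ∈ degreePart σ α (QuadraticAlg.degreePart v q) 0 :=
  (hc 1 1 _ _ (skewVec_mem_degreePart x) (skewVec_mem_degreePart y)).2 0 (by norm_num)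

end Degree

variable (μ) in
/-- The value `μ(v_i, v_j) - q_{ij} μ(v_j, v_i)` of a cocycle on the quadratic relator. -/
def relatorValue (i j : Fin n) : TwistedSkewGroupAlgebra σ α :=
  μ (skewVec σ α (v i)) (skewVec σ α (v j)) - q i j • μ (skewVec σ α (v j)) (skewVec σ α (v i))

theorem relatorValue_mem (hc : HasDegreeNegTwo (degreePart σ α (QuadraticAlg.degreePart v q)) μ)
    (i j : Fin n) : relatorValue μ i j ∈ degreePart σ α (QuadraticAlg.degreePart v q) 0 :=
  Submodule.sub_mem _ (hc.skewVec_skewVec_mem _ _)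
    (Submodule.smul_mem _ _ (hc.skewVec_skewVec_mem _ _))

theorem relatorValue_swap (hq : IsQuantumSystem q) (i j : Fin n) :
    relatorValue μ i j = - (q i j • relatorValue μ j i) := by
  rw [relatorValue, relatorValue, smul_sub, smul_smul, hq.mul_swap, one_smul, neg_sub]

theorem relatorValue_self (hq : IsQuantumSystem q) (i : Fin n) : relatorValue μ i i = 0 := by
  rw [relatorValue, hq.diag, one_smul, sub_self]

/-- Expresses that the two ways of reversing v_i v_j v_l agree to first order in ħ. It is a
combination of the cocycle identities at the six orderings of the letters. The terms with a product
inside μ cancel because the letters q-commute in R. -/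
theorem relatorValue_hexagon (hμ : IsHochschildTwoCocycle μ) (i j l : Fin n) :
    relatorValue μ i j * skewVec σ α (v l) +
      q i j • (skewVec σ α (v j) * relatorValue μ i l) +
      (q i j * q i l) • (relatorValue μ j l * skewVec σ α (v i)) =
    skewVec σ α (v i) * relatorValue μ j l +
      q j l • (relatorValue μ i l * skewVec σ α (v j)) +
      (q j l * q i l) • (skewVec σ α (v l) * relatorValue μ i j) := by
  set x := skewVec σ α (v i) with hx
  set y := skewVec σ α (v j) with hy
  set z := skewVec σ α (v l) with hz
  have hxy : x * y = q i j • (y * x) := skewVec_mul_swap i j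
  have hxz : x * z = q i l • (z * x) := skewVec_mul_swap i l
  have hyz : y * z = q j l • (z * y) := skewVec_mul_swap j l
  have h1 := hμ x y z
  have h2 := hμ y x z
  have h3 := hμ y z x
  have h4 := hμ x z y
  have h5 := hμ z x y
  have h6 := hμ z y x
  simp only [hxy, hxz, hyz, map_smul, LinearMap.smul_apply] at h1 h2 h3 h4 h5 h6
  simp only [relatorValue, ← hx, ← hy, ← hz, sub_mul, mul_sub, smul_mul_assoc, mul_smul_comm,
    smul_sub, smul_smul]
  -- Each coefficient is minus the sign of the permutation times the product of q's that rewrites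
  -- xyz in that order.
  linear_combination (norm := module) (-1 : k) • h1 + (q i j) • h2 - (q i j * q i l) • h3 +
    (q j l) • h4 - (q j l * q i l) • h5 + (q i j * q i l * q j l) • h6

variable (ρ v q) in
/-- The coefficients of the image of a quadratic relator under `g`. -/
def relatorCoeff (g : G) (i j a b : Fin n) : k :=
  v.repr (ρ g (v i)) a * v.repr (ρ g (v j)) b -
    q i j * (v.repr (ρ g (v j)) a * v.repr (ρ g (v i)) b)

/-- The bilinear map is left arbitrary so that one expansion serves multiplication in T(V),
multiplication in R, and μ. -/
theorem sum_relatorCoeff {M : Type*} [AddCommGroup M] [Module k M] (B : V →ₗ[k] V →ₗ[k] M) (g : G)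
    (i j : Fin n) : ∑ a, ∑ b, relatorCoeff v q ρ g i j a b • B (v a) (v b) =
      B (ρ g (v i)) (ρ g (v j)) - q i j • B (ρ g (v j)) (ρ g (v i)) := by
  have h : ∀ x y, B x y = ∑ a, ∑ b, (v.repr x a * v.repr y b) • B (v a) (v b) := by
    intro x y
    conv_lhs => rw [← v.sum_repr x, ← v.sum_repr y]
    simp only [map_sum, LinearMap.sum_apply, map_smul, LinearMap.smul_apply, smul_smul,
      Finset.smul_sum]
    rw [Finset.sum_comm]
    simp only [mul_comm]
  rw [h (ρ g (v i)), h (ρ g (v j))]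
  simp only [relatorCoeff, sub_smul, Finset.sum_sub_distrib, Finset.smul_sum, smul_smul]

theorem tensorAction_relator (g : G) (i j : Fin n) :
    tensorAction ρ g (relator v q i j) = ∑ a, ∑ b, relatorCoeff v q ρ g i j a b •
      (TensorAlgebra.ι k (v a) * TensorAlgebra.ι k (v b)) := by
  have h := sum_relatorCoeff (v := v) (q := q) (ρ := ρ)
    ((LinearMap.mul k (TensorAlgebra k V)).compl₁₂ (TensorAlgebra.ι k) (TensorAlgebra.ι k)) g i j
  simp only [LinearMap.compl₁₂_apply, LinearMap.mul_apply'] at h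
  rw [h]
  simp only [relator, map_sub, map_smul, map_mul, tensorAction_ι]

/-- Because g acts on S_q(V), it sends a relator into the ideal of relations, whose quadratic
elements are q-antisymmetric. -/
theorem relatorCoeff_antisymm (hq : IsQuantumSystem q) (hσ : QuadraticAlg.Extends ρ σ) (g : G)
    (i j a b : Fin n) :
    relatorCoeff v q ρ g i j a b + q b a * relatorCoeff v q ρ g i j b a = 0 := by
  refine coeff_antisymm_of_proj_eq_zero v hq _ ?_ a b
  rw [← tensorAction_relator, hσ.proj_tensorAction, QuadraticAlg.proj_relator, map_zero]

theorem single_mul_relator (hq : IsQuantumSystem q) (h2 : (2 : k) ≠ 0)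
    (hσ : QuadraticAlg.Extends ρ σ) (g : G) (i j : Fin n) :
    single _ α g 1 * single (tensorAction ρ) α 1 (relator v q i j) =
      (∑ a, ∑ b, (2⁻¹ * relatorCoeff v q ρ g i j a b) •
        single (tensorAction ρ) α 1 (relator v q a b)) * single _ α g 1 := by
  rw [single_mul_single_right, tensorAction_relator, sum_smul_eq_sum_half_smul_sub h2
    (relatorCoeff_antisymm hq hσ g i j)]
  simp only [← lsingle_apply, map_sum, map_smul, relator]

/-- Equivariance of κ, with the same coefficients by which t_g passes a relator in
`single_mul_relator`. That coincidence makes the deformed relations stable under G. -/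
theorem single_mul_relatorValue (hq : IsQuantumSystem q) (h2 : (2 : k) ≠ 0)
    (hσ : QuadraticAlg.Extends ρ σ) (hμ : IsHochschildTwoCocycle μ)
    (hc : HasDegreeNegTwo (degreePart σ α (QuadraticAlg.degreePart v q)) μ) (g : G) (i j : Fin n) :
    single σ α g 1 * relatorValue μ i j =
      (∑ a, ∑ b, (2⁻¹ * relatorCoeff v q ρ g i j a b) • relatorValue μ a b) * single σ α g 1 := by
  have h := sum_relatorCoeff (v := v) (q := q) (ρ := ρ)
    (μ.compl₁₂ (skewVec σ α) (skewVec σ α)) g i j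
  have h' := sum_relatorCoeff (v := v) (q := q) (ρ := ρ)
    ((LinearMap.mul k _).compl₁₂ (skewVec σ α) (skewVec σ α)) g i j
  rw [sum_smul_eq_sum_half_smul_sub h2 (relatorCoeff_antisymm hq hσ g i j)] at h h'
  simp only [LinearMap.compl₁₂_apply, LinearMap.mul_apply', ← skewVec_mul_swap, sub_self,
    smul_zero, Finset.sum_const_zero] at h h'
  -- Three cocycle identities move t_g from left to right of the pair x, y. Constancy removes the
  -- terms where μ pairs t_g with a vector.
  have key : ∀ x y, single σ α g 1 * μ (skewVec σ α x) (skewVec σ α y) +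
      μ (single σ α g 1) (skewVec σ α x * skewVec σ α y) =
      μ (skewVec σ α (ρ g x) * skewVec σ α (ρ g y)) (single σ α g 1) +
        μ (skewVec σ α (ρ g x)) (skewVec σ α (ρ g y)) * single σ α g 1 := by
    intro x y
    have e1 := hμ (single σ α g 1) (skewVec σ α x) (skewVec σ α y)
    have e2 := hμ (skewVec σ α (ρ g x)) (single σ α g 1) (skewVec σ α y)
    have e3 := hμ (skewVec σ α (ρ g x)) (skewVec σ α (ρ g y)) (single σ α g 1)
    simp only [hc.single_skewVec, hc.skewVec_single, single_one_mul_skewVec hσ, mul_zero, zero_mul,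
      add_zero, zero_add] at e1 e2 e3
    rw [e1, ← e2, e3]
  have k1 := key (v i) (v j)
  have k2 := key (v j) (v i)
  -- The remaining terms evaluate μ at t_g and a relator or its g-image, and both of these vanish in
  -- R.
  have k3 := congrArg (fun z => μ (single σ α g 1) z) (skewVec_mul_swap (σ := σ) (α := α) i j)
  have k4 := congrArg (fun z => μ z (single σ α g 1)) h'
  simp only [map_smul, map_sub, map_zero, LinearMap.sub_apply, LinearMap.smul_apply,
    LinearMap.zero_apply] at k3 k4
  have h5 : (∑ a, ∑ b, (2⁻¹ * relatorCoeff v q ρ g i j a b) • relatorValue μ a b) =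
      μ (skewVec σ α (ρ g (v i))) (skewVec σ α (ρ g (v j))) -
        q i j • μ (skewVec σ α (ρ g (v j))) (skewVec σ α (ρ g (v i))) := h
  rw [h5, relatorValue, mul_sub, sub_mul, mul_smul_comm, smul_mul_assoc]
  linear_combination (norm := module) k1 - (q i j) • k2 - k3 - k4

end ConstantCocycle

/-! ### T(V) #_α G acting on the square-zero extension -/

section FirstOrder

variable {k G V : Type*} [Field k] [Group G] [AddCommGroup V] [Module k V] {n : ℕ}
  {v : Module.Basis (Fin n) k V} {q : Fin n → Fin n → k} {ρ : Representation k G V}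
  {α : NormalizedTwoCocycle k G} {σ : G →* (QuadraticAlg v q ≃ₐ[k] QuadraticAlg v q)}
  {μ : TwistedSkewGroupAlgebra σ α →ₗ[k] TwistedSkewGroupAlgebra σ α →ₗ[k]
    TwistedSkewGroupAlgebra σ α}

open TwistedSkewGroupAlgebra

/-- On a vector the ε-corrections are values of μ at t_g and a vector, which are zero by degree.
Both sides then extend multiplicatively. -/
theorem squareZeroMul_single_mul_lift (hσ : QuadraticAlg.Extends ρ σ)
    (hμ : IsHochschildTwoCocycle μ)
    (hc : HasDegreeNegTwo (degreePart σ α (QuadraticAlg.degreePart v q)) μ) (g : G)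
    (x : TensorAlgebra k V) :
    squareZeroMul μ (single σ α g 1) *
        TensorAlgebra.lift k (squareZeroMul μ ∘ₗ skewVec σ α) x =
      TensorAlgebra.lift k (squareZeroMul μ ∘ₗ skewVec σ α) (tensorAction ρ g x) *
        squareZeroMul μ (single σ α g 1) := by
  have hι : ∀ y, TensorAlgebra.lift k (squareZeroMul μ ∘ₗ skewVec σ α) (TensorAlgebra.ι k y) =
      squareZeroMul μ (skewVec σ α y) := fun y => TensorAlgebra.lift_ι_apply _ y
  generalize TensorAlgebra.lift k (squareZeroMul μ ∘ₗ skewVec σ α) = f at hι ⊢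
  induction x using TensorAlgebra.induction with
  | algebraMap c =>
    rw [AlgEquiv.commutes, AlgHom.commutes]
    exact (Algebra.commutes _ _).symm
  | ι x =>
    rw [tensorAction_ι, hι, hι, squareZeroMul_mul_squareZeroMul hμ,
      squareZeroMul_mul_squareZeroMul hμ, hc.single_skewVec, hc.skewVec_single,
      single_one_mul_skewVec hσ]
  | mul x y hx hy =>
    rw [map_mul f, map_mul (tensorAction ρ g), map_mul f, ← mul_assoc, hx, mul_assoc, hy, mul_assoc]
  | add x y hx hy =>
    rw [map_add f, map_add (tensorAction ρ g), map_add f, mul_add, add_mul, hx, hy]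

/-- The action of `T(V) #_α G` on the square-zero extension of `S_q(V) #_α G` given by `μ`. -/
def firstOrderRep (hσ : QuadraticAlg.Extends ρ σ) (hμ : IsHochschildTwoCocycle μ)
    (hc : HasDegreeNegTwo (degreePart σ α (QuadraticAlg.degreePart v q)) μ) :
    TwistedSkewGroupAlgebra (tensorAction ρ) α →ₐ[k]
      Module.End k (TwistedSkewGroupAlgebra σ α × TwistedSkewGroupAlgebra σ α) :=
  TwistedSkewGroupAlgebra.lift (TensorAlgebra.lift k (squareZeroMul μ ∘ₗ skewVec σ α))
    (fun g => squareZeroMul μ (single σ α g 1))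
    (squareZeroMul_one hμ (hc.single_single 1 1))
    (fun g h => by
      rw [squareZeroMul_mul_squareZeroMul hμ, hc.single_single, map_zero, add_zero,
        single_mul_single_one, ← smul_single, map_smul])
    (squareZeroMul_single_mul_lift hσ hμ hc)

theorem firstOrderRep_single (hσ : QuadraticAlg.Extends ρ σ) (hμ : IsHochschildTwoCocycle μ)
    (hc : HasDegreeNegTwo (degreePart σ α (QuadraticAlg.degreePart v q)) μ) (g : G)
    (x : TensorAlgebra k V) : firstOrderRep hσ hμ hc (single _ α g x) =
      TensorAlgebra.lift k (squareZeroMul μ ∘ₗ skewVec σ α) x *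
        squareZeroMul μ (single σ α g 1) :=
  lift_single _ _ _ _ _ g x

theorem squareZero_mul_aux (hμ : IsHochschildTwoCocycle μ) (a b z w : TwistedSkewGroupAlgebra σ α) :
    (squareZeroMul μ a + squareZeroIncl k z) * (squareZeroMul μ b + squareZeroIncl k w) =
      squareZeroMul μ (a * b) + squareZeroIncl k (μ a b + a * w + z * b) := by
  rw [mul_add, add_mul, add_mul, squareZeroMul_mul_squareZeroMul hμ,
    squareZeroMul_mul_squareZeroIncl, squareZeroIncl_mul_squareZeroMul,
    squareZeroIncl_mul_squareZeroIncl, map_add, map_add]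
  abel

theorem firstOrderRep_eq (hσ : QuadraticAlg.Extends ρ σ) (hμ : IsHochschildTwoCocycle μ)
    (hc : HasDegreeNegTwo (degreePart σ α (QuadraticAlg.degreePart v q)) μ)
    (X : TwistedSkewGroupAlgebra (tensorAction ρ) α) :
    ∃ z, firstOrderRep hσ hμ hc X =
      squareZeroMul μ (skewProj hσ α X) + squareZeroIncl k z := by
  have hone : squareZeroMul μ (single σ α 1 1) = 1 := squareZeroMul_one hμ (hc.single_single 1 1)
  have hT : ∀ x : TensorAlgebra k V, ∃ z,
      TensorAlgebra.lift k (squareZeroMul μ ∘ₗ skewVec σ α) x =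
        squareZeroMul μ (single σ α 1 (QuadraticAlg.proj v q x)) + squareZeroIncl k z := by
    intro x
    induction x using TensorAlgebra.induction with
    | algebraMap c =>
      refine ⟨0, ?_⟩
      rw [AlgHom.commutes, AlgHom.commutes, Algebra.algebraMap_eq_smul_one,
        Algebra.algebraMap_eq_smul_one, ← smul_single, map_smul, map_zero, add_zero]
      exact congrArg (c • ·) hone.symm
    | ι x =>
      refine ⟨0, ?_⟩
      rw [TensorAlgebra.lift_ι_apply, map_zero, add_zero]
      rfl
    | mul x y hx hy =>
      obtain ⟨z, hx⟩ := hx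
      obtain ⟨w, hy⟩ := hy
      exact ⟨_, by rw [map_mul, hx, hy, squareZero_mul_aux hμ, single_one_mul_single,
        map_mul (QuadraticAlg.proj v q)]⟩
    | add x y hx hy =>
      obtain ⟨z, hx⟩ := hx
      obtain ⟨w, hy⟩ := hy
      refine ⟨z + w, ?_⟩
      rw [map_add, hx, hy, map_add, single_add, map_add, map_add]
      abel
  induction X using TwistedSkewGroupAlgebra.induction with
  | zero => exact ⟨0, by simp⟩
  | add X Y hX hY =>
    obtain ⟨z, hX⟩ := hX
    obtain ⟨w, hY⟩ := hY
    refine ⟨z + w, ?_⟩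
    rw [map_add, hX, hY, map_add, map_add, map_add]
    abel
  | single g x =>
    obtain ⟨z, hx⟩ := hT x
    refine ⟨μ (single σ α 1 (QuadraticAlg.proj v q x)) (single σ α g 1) +
      single σ α 1 (QuadraticAlg.proj v q x) * 0 + z * single σ α g 1, ?_⟩
    rw [firstOrderRep_single, hx, ← add_zero (squareZeroMul μ (single σ α g 1)),
      ← map_zero (squareZeroIncl k), squareZero_mul_aux hμ, skewProj_single,
      single_one_mul_single_one]

/-- The leading part is the relator's image in R, namely zero. What is left is the cocycle's
contribution, and this is why κ is chosen to be `relatorValue`. -/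
theorem firstOrderRep_relator (hσ : QuadraticAlg.Extends ρ σ) (hμ : IsHochschildTwoCocycle μ)
    (hc : HasDegreeNegTwo (degreePart σ α (QuadraticAlg.degreePart v q)) μ) (i j : Fin n) :
    firstOrderRep hσ hμ hc (single _ α 1 (relator v q i j)) =
      squareZeroIncl k (relatorValue μ i j) := by
  have hone : squareZeroMul μ (single σ α 1 1) = 1 := squareZeroMul_one hμ (hc.single_single 1 1)
  rw [firstOrderRep_single, hone, mul_one, relator, map_sub, map_smul, map_mul, map_mul]
  simp only [TensorAlgebra.lift_ι_apply, LinearMap.comp_apply, squareZeroMul_mul_squareZeroMul hμ]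
  rw [skewVec_mul_swap i j, relatorValue, map_sub, map_smul, map_smul, smul_add]
  abel

end FirstOrder

/-! ### Coefficients of powers of ħ -/

section Hbar

variable {k R : Type*} [CommRing k] [Ring R] [Algebra k R]

theorem hbarCoeff_tmul (i : ℕ) (p : k[X]) (r : R) : hbarCoeff k R i (p ⊗ₜ r) = p.coeff i • r := by
  simp [hbarCoeff]

theorem hbarCoeff_one_tmul (i : ℕ) (r : R) :
    hbarCoeff k R i (1 ⊗ₜ r) = if i = 0 then r else 0 := by
  rw [hbarCoeff_tmul, Polynomial.coeff_one]
  split_ifs <;> simp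

theorem hbarCoeff_zero_X_smul (m : k[X] ⊗[k] R) :
    hbarCoeff k R 0 ((Polynomial.X : k[X]) • m) = 0 := by
  induction m using TensorProduct.induction_on with
  | zero => simp
  | add m m' h h' => rw [smul_add, map_add, h, h', add_zero]
  | tmul p r => rw [TensorProduct.smul_tmul', hbarCoeff_tmul]; simp

theorem hbarCoeff_succ_X_smul (i : ℕ) (m : k[X] ⊗[k] R) :
    hbarCoeff k R (i + 1) ((Polynomial.X : k[X]) • m) = hbarCoeff k R i m := by
  induction m using TensorProduct.induction_on with
  | zero => simp
  | add m m' h h' => rw [smul_add, map_add, map_add, h, h']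
  | tmul p r => rw [TensorProduct.smul_tmul', hbarCoeff_tmul, hbarCoeff_tmul]; simp

theorem hbarCoeff_zero_mul_one_tmul (m : k[X] ⊗[k] R) (r : R) :
    hbarCoeff k R 0 (m * (1 ⊗ₜ r)) = hbarCoeff k R 0 m * r := by
  induction m using TensorProduct.induction_on with
  | zero => simp
  | add m m' h h' => rw [add_mul, map_add, map_add, h, h', add_mul]
  | tmul p r => simp [hbarCoeff_tmul]

end Hbar

/-! ### Functions on words compatible with the deformed relations -/

section WordEval

variable {k G V : Type*} [Field k] [Group G] [AddCommGroup V] [Module k V] {n : ℕ}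
  {v : Module.Basis (Fin n) k V} {q : Fin n → Fin n → k} {ρ : Representation k G V}
  {α : NormalizedTwoCocycle k G} {σ : G →* (QuadraticAlg v q ≃ₐ[k] QuadraticAlg v q)}

open TwistedSkewGroupAlgebra

variable (v ρ α) in
/-- A word, as an element of `T(V) #_α G`. -/
def skewWord (w : List (Fin n)) : TwistedSkewGroupAlgebra (tensorAction ρ) α :=
  single _ α 1 (word v w)

theorem skewWord_append (w w' : List (Fin n)) :
    skewWord v ρ α (w ++ w') = skewWord v ρ α w * skewWord v ρ α w' := by
  rw [skewWord, skewWord, skewWord, single_one_mul_single, word_append]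

theorem skewWord_mul_single (w : List (Fin n)) (g : G) :
    skewWord v ρ α w * single _ α g 1 = single _ α g (word v w) :=
  single_one_mul_single_one _ _

theorem skewWord_mem_wordDegree (w : List (Fin n)) :
    skewWord v ρ α w ∈ wordDegree v ρ α w.length :=
  single_word_mem_wordDegree w 1

variable (v q ρ α) in
/-- The relator, as an element of `T(V) #_α G`. -/
def skewRelator (i j : Fin n) : TwistedSkewGroupAlgebra (tensorAction ρ) α :=
  single _ α 1 (relator v q i j)

theorem skewRelator_eq (i j : Fin n) : skewRelator v q ρ α i j =
    skewWord v ρ α [i, j] - q i j • skewWord v ρ α [j, i] := by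
  simp only [skewRelator, skewWord, ← lsingle_apply, relator, map_sub, map_smul, word_cons,
    word_nil, mul_one]

variable (v q ρ α) in
/-- Values `κ i j` prescribed for the quadratic relators of `S_q(V) #_α G`, in degree zero, which
are compatible with the relations between the relators. -/
structure IsRelatorDeformation
    (κ : Fin n → Fin n → TwistedSkewGroupAlgebra (tensorAction ρ) α) : Prop where
  mem : ∀ i j, κ i j ∈ wordDegree v ρ α 0
  swap : ∀ i j, κ i j = - (q i j • κ j i)
  self : ∀ i, κ i i = 0
  equivariant : ∀ (g : G) (i j : Fin n), ∃ b : Fin n → Fin n → k,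
    single _ α g 1 * skewRelator v q ρ α i j =
      (∑ c, ∑ d, b c d • skewRelator v q ρ α c d) * single _ α g 1 ∧
    single _ α g 1 * κ i j = (∑ c, ∑ d, b c d • κ c d) * single _ α g 1
  hexagon : ∀ i j l,
    κ i j * skewWord v ρ α [l] + q i j • (skewWord v ρ α [j] * κ i l) +
        (q i j * q i l) • (κ j l * skewWord v ρ α [i]) =
      skewWord v ρ α [i] * κ j l + q j l • (κ i l * skewWord v ρ α [j]) +
        (q j l * q i l) • (skewWord v ρ α [l] * κ i j)

variable (v ρ) in
/-- The linear map `T(V) #_α G → (S_q(V) #_α G)[ħ]`, compatible with right multiplication by the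
elements `t_g`, which has the given values on words. -/
def wordEval (f : List (Fin n) → k[X] ⊗[k] TwistedSkewGroupAlgebra σ α) :
    TwistedSkewGroupAlgebra (tensorAction ρ) α →ₗ[k] k[X] ⊗[k] TwistedSkewGroupAlgebra σ α :=
  linearLift fun g => LinearMap.mulRight k (1 ⊗ₜ single σ α g 1) ∘ₗ wordLift v f

variable {f f' : List (Fin n) → k[X] ⊗[k] TwistedSkewGroupAlgebra σ α}

theorem wordEval_single (g : G) (w : List (Fin n)) :
    wordEval v ρ f (single _ α g (word v w)) = f w * (1 ⊗ₜ single σ α g 1) := by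
  rw [wordEval, linearLift_single, LinearMap.comp_apply, wordLift_word, LinearMap.mulRight_apply]

theorem wordEval_skewWord (w : List (Fin n)) : wordEval v ρ f (skewWord v ρ α w) = f w := by
  rw [skewWord, wordEval_single]
  exact mul_one (f w)

theorem wordEval_congr {d : ℕ} (h : ∀ w, w.length = d → f w = f' w)
    {X : TwistedSkewGroupAlgebra (tensorAction ρ) α} (hX : X ∈ wordDegree v ρ α d) :
    wordEval v ρ f X = wordEval v ρ f' X := by
  refine LinearMap.eqOn_span (f := wordEval v ρ f) (g := wordEval v ρ f') ?_ hX
  rintro _ ⟨w, g, hw, rfl⟩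
  rw [wordEval_single, wordEval_single, h w hw]

theorem linearMap_ext_single_word {M : Type*} [AddCommGroup M] [Module k M]
    {φ ψ : TwistedSkewGroupAlgebra (tensorAction ρ) α →ₗ[k] M}
    (h : ∀ g w, φ (single _ α g (word v w)) = ψ (single _ α g (word v w))) : φ = ψ :=
  TwistedSkewGroupAlgebra.linearMap_ext fun g x => by
    have h' : φ ∘ₗ lsingle _ α g = ψ ∘ₗ lsingle _ α g := linearMap_ext_word v (h g)
    exact LinearMap.congr_fun h' x

variable (κ : Fin n → Fin n → TwistedSkewGroupAlgebra (tensorAction ρ) α)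

/-- The compatibility of `f` in degree `d` with the relations `v_i v_j - q_{ij} v_j v_i = ħ κ_ij`.-/
def IsCompatible (f : List (Fin n) → k[X] ⊗[k] TwistedSkewGroupAlgebra σ α) (d : ℕ) : Prop :=
  ∀ x i j y, List.length x + List.length y + 2 = d →
    f (x ++ i :: j :: y) - q i j • f (x ++ j :: i :: y) =
      (Polynomial.X : k[X]) • wordEval v ρ f (skewWord v ρ α x * κ i j * skewWord v ρ α y)

variable {κ}

/-- Compatibility is imposed on pure words only. Group elements on the right are built into
`wordEval`, and those between A and the relator are moved right by equivariance. -/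
theorem IsCompatible.wordEval_relator (hκ : IsRelatorDeformation v q ρ α κ) {d : ℕ}
    (hf : IsCompatible κ f d) {a b : ℕ} (hab : a + b + 2 = d)
    {A B : TwistedSkewGroupAlgebra (tensorAction ρ) α}
    (hA : A ∈ wordDegree v ρ α a) (hB : B ∈ wordDegree v ρ α b) (i j : Fin n) :
    wordEval v ρ f (A * skewRelator v q ρ α i j * B) =
      (Polynomial.X : k[X]) • wordEval v ρ f (A * κ i j * B) := by
  have hright : ∀ (X : TwistedSkewGroupAlgebra (tensorAction ρ) α) g,
      wordEval v ρ f (X * single _ α g 1) = wordEval v ρ f X * (1 ⊗ₜ single σ α g 1) := by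
    intro X g
    have : wordEval v ρ f ∘ₗ LinearMap.mulRight k (single _ α g 1) =
        LinearMap.mulRight k (1 ⊗ₜ single σ α g 1) ∘ₗ wordEval v ρ f := by
      refine linearMap_ext_single_word (v := v) fun h w => ?_
      rw [LinearMap.comp_apply, LinearMap.comp_apply, LinearMap.mulRight_apply,
        LinearMap.mulRight_apply, single_mul_single_one, ← smul_single, map_smul, wordEval_single,
        wordEval_single, mul_assoc, Algebra.TensorProduct.tmul_mul_tmul, single_mul_single_one,
        ← smul_single, TensorProduct.tmul_smul, mul_smul_comm, mul_one]
    exact LinearMap.congr_fun this X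
  have hword : ∀ x, List.length x = a → ∀ i j, ∀ B ∈ wordDegree v ρ α b,
      wordEval v ρ f (skewWord v ρ α x * skewRelator v q ρ α i j * B) =
        (Polynomial.X : k[X]) • wordEval v ρ f (skewWord v ρ α x * κ i j * B) := by
    intro x hx i j B hB
    induction hB using Submodule.span_induction with
    | zero => simp
    | add B B' _ _ h h' => rw [mul_add, mul_add, map_add, map_add, h, h', smul_add]
    | smul c B _ h => rw [mul_smul_comm, mul_smul_comm, map_smul, map_smul, h, smul_comm]
    | mem B hB =>
      obtain ⟨y, g, hy, rfl⟩ := hB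
      rw [← skewWord_mul_single, ← mul_assoc, ← mul_assoc, hright, hright, ← smul_mul_assoc,
        ← hf x i j y (by omega), skewRelator_eq, mul_sub, sub_mul, mul_smul_comm, smul_mul_assoc,
        ← skewWord_append, ← skewWord_append, ← skewWord_append, ← skewWord_append, map_sub,
        map_smul, wordEval_skewWord, wordEval_skewWord]
      simp only [List.append_assoc, List.cons_append, List.nil_append]
  induction hA using Submodule.span_induction with
  | zero => simp
  | add B B' _ _ h h' =>
    rw [add_mul, add_mul, add_mul, add_mul, map_add, map_add, h, h', smul_add]
  | smul c B _ h =>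
    rw [smul_mul_assoc, smul_mul_assoc, smul_mul_assoc, smul_mul_assoc, map_smul, map_smul, h,
      smul_comm]
  | mem A hA =>
    obtain ⟨x, g, hx, rfl⟩ := hA
    -- The same coefficients serve the relators and their prescribed values, so passing t_g
    -- preserves the desired equality.
    obtain ⟨c, hc, hc'⟩ := hκ.equivariant g i j
    have hgB : single _ α g 1 * B ∈ wordDegree v ρ α b := by
      simpa using mul_mem_wordDegree (single_one_mem_wordDegree (v := v) g) hB
    rw [← skewWord_mul_single, mul_assoc (skewWord v ρ α x), hc,
      mul_assoc (skewWord v ρ α x) _ (κ i j), hc']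
    simp only [mul_assoc, Finset.sum_mul, Finset.mul_sum, map_sum, Finset.smul_sum]
    refine Finset.sum_congr rfl fun a _ => Finset.sum_congr rfl fun b _ => ?_
    simp only [smul_mul_assoc, mul_smul_comm, map_smul]
    rw [smul_comm (Polynomial.X : k[X])]
    congr 1
    simpa only [mul_assoc] using hword x hx a b _ hgB

-- Division by `invWeight` turns the q-swap condition in degree d into ordinary differences along
-- transpositions. The right-hand sides involve only words of length d - 2, so they are known before
-- L is sought.
open InsertionSort in
theorem IsCompatible.exists_differences (hq : IsQuantumSystem q)
    (hκ : IsRelatorDeformation v q ρ α κ)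
    {d : ℕ} (hf : ∀ e < d, IsCompatible κ f e) :
    ∃ L : List (Fin n) → k[X] ⊗[k] TwistedSkewGroupAlgebra σ α, ∀ x i j y,
      List.length x + List.length y + 2 = d →
        L (x ++ i :: j :: y) - L (x ++ j :: i :: y) = (invWeight q (x ++ i :: j :: y))⁻¹ •
          wordEval v ρ f (skewWord v ρ α x * κ i j * skewWord v ρ α y) := by
  -- Set to zero off length d, so that the integrability conditions hold trivially there.
  let φ : List (Fin n) → Fin n → Fin n → List (Fin n) → k[X] ⊗[k] TwistedSkewGroupAlgebra σ α :=
    fun x i j y => if x.length + y.length + 2 = d then (invWeight q (x ++ i :: j :: y))⁻¹ •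
          wordEval v ρ f (skewWord v ρ α x * κ i j * skewWord v ρ α y) else 0
  have hinv : ∀ x i j y, (invWeight q (x ++ j :: i :: y))⁻¹ =
      q i j * (invWeight q (x ++ i :: j :: y))⁻¹ := by
    intro x i j y
    rw [invWeight_swap hq x i j y, mul_inv, mul_inv_cancel_left₀ (hq.ne_zero i j)]
  suffices H : ∃ L : List (Fin n) → k[X] ⊗[k] TwistedSkewGroupAlgebra σ α,
      ∀ x i j y, L (x ++ i :: j :: y) - L (x ++ j :: i :: y) = φ x i j y by
    obtain ⟨L, hL⟩ := H
    refine ⟨L, fun x i j y h => ?_⟩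
    rw [hL]
    simp only [φ, h, if_true]
  refine exists_potential ?_ ?_ ?_ ?_
  · intro x i j y
    simp only [φ]
    split_ifs
    · rw [hκ.swap i j, hinv x i j y]
      simp only [mul_neg, neg_mul, map_neg, mul_smul_comm, smul_mul_assoc, map_smul, smul_neg,
        smul_smul]
      rw [mul_comm]
    · simp
  · intro x i y
    simp [φ, hκ.self]
  · intro x i j y a b z
    have hlen : x.length + (y ++ b :: a :: z).length + 2 =
      x.length + (y ++ a :: b :: z).length + 2 := by simp
    have hlen1 : (x ++ j :: i :: y).length + z.length + 2 =
      x.length + (y ++ a :: b :: z).length + 2 := by simp; omega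
    have hlen2 : (x ++ i :: j :: y).length + z.length + 2 =
      x.length + (y ++ a :: b :: z).length + 2 := by simp; omega
    simp only [φ, hlen, hlen1, hlen2]
    split_ifs with hd
    · have hcompat : IsCompatible κ f (x.length + y.length + z.length + 2) :=
        hf _ (by rw [← hd]; simp; omega)
      have e1 := hcompat.wordEval_relator hκ (by omega)
        (mul_mem_wordDegree (mul_mem_wordDegree (skewWord_mem_wordDegree (α := α) x) (hκ.mem i j))
          (skewWord_mem_wordDegree y)) (skewWord_mem_wordDegree z) a b
      have e2 := hcompat.wordEval_relator hκ (by omega) (skewWord_mem_wordDegree x)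
        (mul_mem_wordDegree (mul_mem_wordDegree (skewWord_mem_wordDegree (α := α) y) (hκ.mem a b))
          (skewWord_mem_wordDegree z)) i j
      -- Both sides equal ħ times the value at x κ_ij y κ_ab z. This uses compatibility in length d
      -- - 2, and it is the square relation.
      have e3 : wordEval v ρ f (skewWord v ρ α x * κ i j * skewWord v ρ α y *
          skewRelator v q ρ α a b * skewWord v ρ α z) =
          wordEval v ρ f (skewWord v ρ α x * skewRelator v q ρ α i j *
            (skewWord v ρ α y * κ a b * skewWord v ρ α z)) := by
        rw [e1, e2]
        simp only [mul_assoc]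
      have h1 := hinv (x ++ i :: j :: y) a b z
      have h2 := hinv x i j (y ++ a :: b :: z)
      simp only [List.append_assoc, List.cons_append] at h1 h2 ⊢
      rw [h1, h2]
      have w1 : ∀ i j : Fin n, skewWord v ρ α (x ++ i :: j :: y) =
          skewWord v ρ α x * (skewWord v ρ α [i, j] * skewWord v ρ α y) := by
        intro i j
        rw [← skewWord_append, ← skewWord_append]
        rfl
      have w2 : ∀ i j : Fin n, skewWord v ρ α (y ++ i :: j :: z) =
          skewWord v ρ α y * (skewWord v ρ α [i, j] * skewWord v ρ α z) := by
        intro i j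
        rw [← skewWord_append, ← skewWord_append]
        rfl
      rw [skewRelator_eq, skewRelator_eq] at e3
      simp only [w1, w2, mul_sub, sub_mul, mul_smul_comm, smul_mul_assoc, map_sub, map_smul,
        mul_assoc] at e3 ⊢
      linear_combination (norm := module)
        ((invWeight q (x ++ i :: j :: (y ++ a :: b :: z)))⁻¹) • e3
    · rfl
  · intro x i j l y
    simp only [φ, List.length_append, List.length_cons, List.length_nil, zero_add]
    have hl : x.length + 1 + y.length + 2 = x.length + (y.length + 1) + 2 := by omega
    simp only [hl]
    split_ifs with hd
    · have h1 := hinv x i j (l :: y)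
      have h2 := hinv (x ++ [j]) i l y
      have h3 := hinv (x ++ [i]) j l y
      have h4 := hinv x i l (j :: y)
      simp only [List.append_assoc, List.cons_append, List.nil_append] at h1 h2 h3 h4 ⊢
      rw [h4, h3, h2, h1]
      have w1 : ∀ i : Fin n, skewWord v ρ α (x ++ [i]) = skewWord v ρ α x * skewWord v ρ α [i] :=
        fun i => skewWord_append _ _
      have w2 : ∀ i : Fin n, skewWord v ρ α (i :: y) = skewWord v ρ α [i] * skewWord v ρ α y :=
        fun i => skewWord_append [i] y
      -- The hexagon needs only the linear identity for κ, placed between the words x and y.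
      have e := congrArg (fun z => wordEval v ρ f (skewWord v ρ α x * z * skewWord v ρ α y))
        (hκ.hexagon i j l)
      simp only [mul_add, add_mul, mul_smul_comm, smul_mul_assoc, map_add, map_smul, w1, w2,
        mul_assoc] at e ⊢
      linear_combination (norm := module) ((invWeight q (x ++ i :: j :: l :: y))⁻¹) • e
    · simp

end WordEval

/-! ### Injectivity of a map that is the identity modulo ħ -/

/-- The constant term of a kernel element is zero, so the element is ħ times one with fewer
coefficients. Since ħ is a nonzerodivisor on R[ħ], that one is again in the kernel. -/
theorem injective_of_hbarCoeff_zero {k R : Type*} [CommRing k] [Ring R] [Algebra k R]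
    (Φ : k[X] ⊗[k] R →ₗ[k[X]] k[X] ⊗[k] R) (hΦ : ∀ r, hbarCoeff k R 0 (Φ (1 ⊗ₜ r)) = r) :
    Function.Injective Φ := by
  have hX : ∀ m : k[X] ⊗[k] R, (Polynomial.X : k[X]) • m = 0 → ∀ i, hbarCoeff k R i m = 0 := by
    intro m hm i
    rw [← hbarCoeff_succ_X_smul, hm, map_zero]
  have hext : ∀ (N : ℕ) (c : ℕ → R), (∀ i, hbarCoeff k R i
      (∑ j ∈ Finset.range N, ((Polynomial.X : k[X]) ^ j) ⊗ₜ[k] c j) = 0) →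
      ∑ j ∈ Finset.range N, ((Polynomial.X : k[X]) ^ j) ⊗ₜ[k] c j = 0 := by
    intro N c h
    refine Finset.sum_eq_zero fun j hj => ?_
    have := h j
    rw [map_sum, Finset.sum_eq_single j] at this
    · rw [hbarCoeff_tmul, Polynomial.coeff_X_pow, if_pos rfl, one_smul] at this
      rw [this, TensorProduct.tmul_zero]
    · intro l _ hl
      rw [hbarCoeff_tmul, Polynomial.coeff_X_pow, if_neg hl.symm, zero_smul]
    · exact fun h => absurd hj h
  have hrep : ∀ m : k[X] ⊗[k] R, ∃ (N : ℕ) (c : ℕ → R),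
      m = ∑ j ∈ Finset.range N, ((Polynomial.X : k[X]) ^ j) ⊗ₜ[k] c j := by
    intro m
    have hpad : ∀ (N M : ℕ) (c : ℕ → R), N ≤ M →
        ∑ j ∈ Finset.range N, ((Polynomial.X : k[X]) ^ j) ⊗ₜ[k] c j =
        ∑ j ∈ Finset.range M, ((Polynomial.X : k[X]) ^ j) ⊗ₜ[k] (if j < N then c j else 0) := by
      intro N M c h
      rw [← Finset.sum_subset (Finset.range_subset_range.mpr h)]
      · refine Finset.sum_congr rfl fun j hj => ?_
        rw [if_pos (Finset.mem_range.mp hj)]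
      · intro j _ hj
        rw [if_neg (by simpa using hj), TensorProduct.tmul_zero]
    induction m using TensorProduct.induction_on with
    | zero => exact ⟨0, 0, by simp⟩
    | add m m' h h' =>
      obtain ⟨N, c, rfl⟩ := h
      obtain ⟨N', c', rfl⟩ := h'
      refine ⟨max N N', fun j => (if j < N then c j else 0) + if j < N' then c' j else 0, ?_⟩
      rw [hpad N _ c (le_max_left N N'), hpad N' _ c' (le_max_right N N'),
        ← Finset.sum_add_distrib]
      exact Finset.sum_congr rfl fun j _ => (TensorProduct.tmul_add _ _ _).symm
    | tmul p r =>
      refine ⟨p.natDegree + 1, fun j => p.coeff j • r, ?_⟩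
      conv_lhs => rw [p.as_sum_range_C_mul_X_pow, TensorProduct.sum_tmul]
      refine Finset.sum_congr rfl fun j _ => ?_
      rw [← Polynomial.smul_eq_C_mul, TensorProduct.smul_tmul]
  have key : ∀ (N : ℕ) (c : ℕ → R),
      Φ (∑ j ∈ Finset.range N, ((Polynomial.X : k[X]) ^ j) ⊗ₜ[k] c j) = 0 →
      ∑ j ∈ Finset.range N, ((Polynomial.X : k[X]) ^ j) ⊗ₜ[k] c j = 0 := by
    intro N
    induction N with
    | zero => intro c _; simp
    | succ N ih =>
      intro c h
      have hs : ∑ j ∈ Finset.range (N + 1), ((Polynomial.X : k[X]) ^ j) ⊗ₜ[k] c j =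
          (Polynomial.X : k[X]) •
            ∑ j ∈ Finset.range N, ((Polynomial.X : k[X]) ^ j) ⊗ₜ[k] c (j + 1) + 1 ⊗ₜ c 0 := by
        rw [Finset.sum_range_succ', Finset.smul_sum, pow_zero]
        congr 1
        refine Finset.sum_congr rfl fun j _ => ?_
        rw [TensorProduct.smul_tmul', smul_eq_mul, ← pow_succ']
      rw [hs, map_add, map_smul] at h
      have h0 : c 0 = 0 := by
        have := congrArg (hbarCoeff k R 0) h
        rwa [map_add, hbarCoeff_zero_X_smul, hΦ, zero_add, map_zero] at this
      rw [h0, TensorProduct.tmul_zero, map_zero, add_zero] at h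
      rw [hs, h0, TensorProduct.tmul_zero, add_zero]
      -- Cancellation of ħ: all coefficients of this image vanish by `hX`, and then the image itself
      -- by `hext`.
      obtain ⟨M, b, hb⟩ := hrep (Φ
        (∑ j ∈ Finset.range N, ((Polynomial.X : k[X]) ^ j) ⊗ₜ[k] c (j + 1)))
      have h1 := hX _ h
      rw [hb] at h1
      rw [ih (fun j => c (j + 1)) (hb.trans (hext M b h1)), smul_zero]
  rw [injective_iff_map_eq_zero]
  intro m hm
  obtain ⟨N, c, rfl⟩ := hrep m
  exact key N c hm

/-! ### The deformed algebra and its PBW property -/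

section Deformed

variable {k G V : Type*} [Field k] [Group G] [AddCommGroup V] [Module k V] {n : ℕ}
  {v : Module.Basis (Fin n) k V} {q : Fin n → Fin n → k} {ρ : Representation k G V}
  {α : NormalizedTwoCocycle k G} {σ : G →* (QuadraticAlg v q ≃ₐ[k] QuadraticAlg v q)}

open TwistedSkewGroupAlgebra

variable {κ : Fin n → Fin n → TwistedSkewGroupAlgebra (tensorAction ρ) α}

/-- The function is built one word length at a time. Compatibility in degree d relates values on
length d to values on length d - 2, so defining length d leaves the lower degrees intact. -/
theorem exists_isCompatible (σ : G →* (QuadraticAlg v q ≃ₐ[k] QuadraticAlg v q))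
    (hq : IsQuantumSystem q) (hκ : IsRelatorDeformation v q ρ α κ) :
    ∃ f : List (Fin n) → k[X] ⊗[k] TwistedSkewGroupAlgebra σ α, (∀ d, IsCompatible κ f d) ∧
      ∀ w, hbarCoeff k _ 0 (f w) = single σ α 1 (QuadraticAlg.proj v q (word v w)) := by
  let Good : ℕ → (List (Fin n) → k[X] ⊗[k] TwistedSkewGroupAlgebra σ α) → Prop := fun d f =>
    (∀ e < d, IsCompatible κ f e) ∧
      ∀ w, hbarCoeff k _ 0 (f w) = single σ α 1 (QuadraticAlg.proj v q (word v w))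
  have hcongr : ∀ f f' : List (Fin n) → k[X] ⊗[k] TwistedSkewGroupAlgebra σ α, ∀ d,
      (∀ w, w.length ≤ d → f w = f' w) → IsCompatible κ f d → IsCompatible κ f' d := by
    intro f f' d h hf x i j y hd
    have hm := mul_mem_wordDegree (mul_mem_wordDegree (skewWord_mem_wordDegree (α := α) x)
      (hκ.mem i j)) (skewWord_mem_wordDegree y)
    rw [← h _ (by simp; omega), ← h _ (by simp; omega), hf x i j y hd]
    congr 1
    exact wordEval_congr (fun w hw => h w (by omega)) hm
  have step : ∀ d f, Good d f → ∃ f', Good (d + 1) f' ∧ ∀ w, w.length ≠ d → f' w = f w := by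
    intro d f hf
    obtain ⟨L, hL⟩ := IsCompatible.exists_differences hq hκ hf.1
    -- The leading term q-commutes exactly. The weight multiplying L undoes the division made in
    -- `IsCompatible.exists_differences`.
    let f' : List (Fin n) → k[X] ⊗[k] TwistedSkewGroupAlgebra σ α := fun w =>
      if w.length = d then 1 ⊗ₜ single σ α 1 (QuadraticAlg.proj v q (word v w)) +
        (Polynomial.X : k[X]) • invWeight q w • L w else f w
    have hne : ∀ w, w.length ≠ d → f' w = f w := fun w hw => by simp only [f', hw, if_false]
    refine ⟨f', ⟨fun e he => ?_, fun w => ?_⟩, hne⟩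
    · rcases Nat.lt_succ_iff_lt_or_eq.mp he with he | rfl
      · exact hcongr f f' e (fun w hw => (hne w (by omega)).symm) (hf.1 e he)
      · intro x i j y hd
        have hm := mul_mem_wordDegree (mul_mem_wordDegree (skewWord_mem_wordDegree (α := α) x)
          (hκ.mem i j)) (skewWord_mem_wordDegree y)
        have h1 : (x ++ i :: j :: y).length = e := by simp; omega
        have h2 : (x ++ j :: i :: y).length = e := by simp; omega
        have h3 : wordEval v ρ f' (skewWord v ρ α x * κ i j * skewWord v ρ α y) =
            wordEval v ρ f (skewWord v ρ α x * κ i j * skewWord v ρ α y) :=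
          wordEval_congr (fun w hw => hne w (by omega)) hm
        have h4 := hL x i j y hd
        rw [sub_eq_iff_eq_add] at h4
        simp only [f', h1, h2, if_true] at h3 ⊢
        rw [h3, h4, smul_add (invWeight q _), smul_inv_smul₀ (invWeight_ne_zero hq _),
          QuadraticAlg.proj_word_swap, invWeight_swap hq x i j y, ← smul_single,
          TensorProduct.tmul_smul, smul_add, smul_add, smul_comm (q i j) (Polynomial.X : k[X]),
          smul_smul (q i j)]
        abel
    · simp only [f']
      split_ifs
      · rw [map_add, hbarCoeff_zero_X_smul, hbarCoeff_one_tmul, if_pos rfl, add_zero]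
      · exact hf.2 w
  choose! next hnext hnext' using step
  -- Values on words of length d are final from stage d + 1 on, so the limit is read off there.
  let seq : ℕ → List (Fin n) → k[X] ⊗[k] TwistedSkewGroupAlgebra σ α := fun d =>
    Nat.rec (fun w => 1 ⊗ₜ single σ α 1 (QuadraticAlg.proj v q (word v w))) (fun d f => next d f) d
  have hseq : ∀ d, Good d (seq d) := by
    intro d
    induction d with
    | zero =>
      exact ⟨fun e he => absurd he (Nat.not_lt_zero e),
        fun w => (hbarCoeff_one_tmul 0 _).trans (if_pos rfl)⟩
    | succ d ih => exact hnext d _ ih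
  have hstable : ∀ w d, List.length w + 1 ≤ d → seq d w = seq (w.length + 1) w := by
    intro w d hd
    induction d, hd using Nat.le_induction with
    | base => rfl
    | succ d hd ih => exact (hnext' d _ (hseq d) w (by omega)).trans ih
  refine ⟨fun w => seq (w.length + 1) w, fun d => ?_, fun w => (hseq (w.length + 1)).2 w⟩
  exact hcongr (seq (d + 1)) _ d (fun w hw => hstable w (d + 1) (by omega))
    ((hseq (d + 1)).1 d (Nat.lt_succ_self d))

theorem hbarCoeff_zero_wordEval (hσ : QuadraticAlg.Extends ρ σ)
    {f : List (Fin n) → k[X] ⊗[k] TwistedSkewGroupAlgebra σ α}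
    (hf : ∀ w, hbarCoeff k _ 0 (f w) = single σ α 1 (QuadraticAlg.proj v q (word v w)))
    (X : TwistedSkewGroupAlgebra (tensorAction ρ) α) :
    hbarCoeff k _ 0 (wordEval v ρ f X) = skewProj hσ α X := by
  have h : hbarCoeff k _ 0 ∘ₗ wordEval v ρ f = (skewProj hσ α).toLinearMap := by
    refine linearMap_ext_single_word (v := v) fun g w => ?_
    rw [LinearMap.comp_apply, wordEval_single, hbarCoeff_zero_mul_one_tmul, hf,
      single_one_mul_single_one]
    exact (skewProj_single hσ g _).symm
  exact LinearMap.congr_fun h X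

theorem wordEval_mul_skewRelator_mul (hκ : IsRelatorDeformation v q ρ α κ)
    {f : List (Fin n) → k[X] ⊗[k] TwistedSkewGroupAlgebra σ α} (hf : ∀ d, IsCompatible κ f d)
    (A B : TwistedSkewGroupAlgebra (tensorAction ρ) α) (i j : Fin n) :
    wordEval v ρ f (A * skewRelator v q ρ α i j * B) =
      (Polynomial.X : k[X]) • wordEval v ρ f (A * κ i j * B) := by
  have h : (LinearMap.mul k _).compr₂ (wordEval v ρ f) ∘ₗ
      LinearMap.mulRight k (skewRelator v q ρ α i j) =
      ((LinearMap.mul k _).compr₂ (wordEval v ρ f) ∘ₗ LinearMap.mulRight k (κ i j)).compr₂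
        (LinearMap.lsmul k[X] (k[X] ⊗[k] TwistedSkewGroupAlgebra σ α)
          Polynomial.X |>.restrictScalars k) := by
    refine linearMap_ext_single_word (v := v) fun g w => linearMap_ext_single_word (v := v)
      fun g' w' => ?_
    exact (hf _).wordEval_relator hκ rfl (single_word_mem_wordDegree w g)
      (single_word_mem_wordDegree w' g') i j
  exact LinearMap.congr_fun (LinearMap.congr_fun h A) B

variable (q) in
/-- The relations `v_i v_j - q_{ij} v_j v_i = ħ κ_{ij}`. -/
inductive DeformedRel (κ : Fin n → Fin n → TwistedSkewGroupAlgebra (tensorAction ρ) α) :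
    k[X] ⊗[k] TwistedSkewGroupAlgebra (tensorAction ρ) α →
    k[X] ⊗[k] TwistedSkewGroupAlgebra (tensorAction ρ) α → Prop
  | rel (i j : Fin n) : DeformedRel κ (1 ⊗ₜ skewRelator v q ρ α i j) (Polynomial.X ⊗ₜ κ i j)

variable (v q) in
/-- The algebra generated by `T(V) #_α G` and `ħ` with the relations
`v_i v_j - q_{ij} v_j v_i = ħ κ_{ij}`. -/
def DeformedAlg (κ : Fin n → Fin n → TwistedSkewGroupAlgebra (tensorAction ρ) α) : Type _ :=
  RingQuot (DeformedRel (v := v) q κ)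

instance : Ring (DeformedAlg v q κ) := inferInstanceAs (Ring (RingQuot _))

instance : Algebra k[X] (DeformedAlg v q κ) := inferInstanceAs (Algebra k[X] (RingQuot _))

instance : Algebra k (DeformedAlg v q κ) := inferInstanceAs (Algebra k (RingQuot _))

instance : IsScalarTower k k[X] (DeformedAlg v q κ) :=
  inferInstanceAs (IsScalarTower k k[X] (RingQuot _))

variable (v q) in
/-- The projection onto the deformed algebra. -/
def DeformedAlg.proj (κ : Fin n → Fin n → TwistedSkewGroupAlgebra (tensorAction ρ) α) :
    k[X] ⊗[k] TwistedSkewGroupAlgebra (tensorAction ρ) α →ₐ[k[X]] DeformedAlg v q κ :=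
  RingQuot.mkAlgHom k[X] (DeformedRel (v := v) q κ)

/-- The linear map from the trivial deformation to the deformed algebra which is given by
ordered words. -/
def DeformedAlg.ofSection (κ : Fin n → Fin n → TwistedSkewGroupAlgebra (tensorAction ρ) α)
    (σ : G →* (QuadraticAlg v q ≃ₐ[k] QuadraticAlg v q))
    (s : QuadraticAlg v q →ₗ[k] TensorAlgebra k V) :
    k[X] ⊗[k] TwistedSkewGroupAlgebra σ α →ₗ[k[X]] DeformedAlg v q κ :=
  (DeformedAlg.proj v q κ).toLinearMap ∘ₗ (skewSection ρ α σ s).baseChange k[X]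

theorem DeformedAlg.ofSection_tmul (s : QuadraticAlg v q →ₗ[k] TensorAlgebra k V) (p : k[X])
    (x : TwistedSkewGroupAlgebra σ α) :
    ofSection κ σ s (p ⊗ₜ x) = proj v q κ (p ⊗ₜ skewSection ρ α σ s x) := rfl

theorem DeformedAlg.proj_rel (i j : Fin n) : proj v q κ (1 ⊗ₜ skewRelator v q ρ α i j) =
    proj v q κ (Polynomial.X ⊗ₜ κ i j) :=
  RingQuot.mkAlgHom_rel k[X] (DeformedRel.rel i j)

/-- A compatible f gives a map to R[ħ] that factors through the deformed algebra. Composed with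
ordered words it is the identity modulo ħ, hence injective. -/
theorem DeformedAlg.ofSection_injective (hq : IsQuantumSystem q) (hσ : QuadraticAlg.Extends ρ σ)
    (hκ : IsRelatorDeformation v q ρ α κ) {s : QuadraticAlg v q →ₗ[k] TensorAlgebra k V}
    (hs : ∀ a, QuadraticAlg.proj v q (s a) = a) :
    Function.Injective (ofSection κ σ s) := by
  obtain ⟨f, hf, hf0⟩ := exists_isCompatible σ hq hκ
  let p := LinearMap.liftBaseChange k[X] (wordEval v ρ f)
  have hp : ∀ x y, proj v q κ x = proj v q κ y → p x = p y := by
    intro x y h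
    refine RingQuot.map_eq_of_mkAlgHom_eq (k := k[X]) _ p.toAddMonoidHom ?_ h
    rintro a b _ _ ⟨i, j⟩
    change p _ = p _
    induction a using TensorProduct.induction_on with
    | zero => simp
    | add a a' h h' => rw [add_mul, add_mul, add_mul, add_mul, map_add, map_add, h, h']
    | tmul c A =>
    induction b using TensorProduct.induction_on with
    | zero => simp
    | add a a' h h' => rw [mul_add, mul_add, map_add, map_add, h, h']
    | tmul d B =>
    simp only [Algebra.TensorProduct.tmul_mul_tmul, p, LinearMap.liftBaseChange_tmul,
      wordEval_mul_skewRelator_mul hκ hf, smul_smul]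
    congr 1
    ring
  have hinj := injective_of_hbarCoeff_zero (p ∘ₗ (skewSection ρ α σ s).baseChange k[X])
    (fun r => by
      rw [LinearMap.comp_apply, LinearMap.baseChange_tmul, LinearMap.liftBaseChange_tmul, one_smul,
        hbarCoeff_zero_wordEval hσ hf0, skewProj_skewSection hσ hs])
  exact fun x y h => hinj (hp _ _ h)

/-- A swap costs ħ x κ_ij y, which is two letters shorter and so in the range by induction. Modulo
the range, words therefore q-commute and equal their ordered forms, which lie in the range. -/
theorem DeformedAlg.ofSection_surjective (hq : IsQuantumSystem q)
    (hκ : IsRelatorDeformation v q ρ α κ) {s : QuadraticAlg v q →ₗ[k] TensorAlgebra k V}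
    (hs : ∀ x, s (QuadraticAlg.proj v q x) = normalOrder v q x) :
    Function.Surjective (ofSection κ σ s) := by
  have hword : ∀ d w g, List.length w = d →
      proj v q κ (1 ⊗ₜ single _ α g (word v w)) ∈ LinearMap.range (ofSection κ σ s) := by
    intro d
    induction d using Nat.strong_induction_on with
    | _ d ih =>
    intro w₀ g hw₀
    have ih' : ∀ e < d, ∀ X ∈ wordDegree v ρ α e,
        proj v q κ (1 ⊗ₜ X) ∈ LinearMap.range (ofSection κ σ s) := by
      intro e he X hX
      induction hX using Submodule.span_induction with
      | zero => simp
      | add X Y _ _ h h' =>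
        rw [TensorProduct.tmul_add, map_add]
        exact Submodule.add_mem _ h h'
      | smul c X _ h =>
        have : (1 : k[X]) ⊗ₜ[k] (c • X) = (Polynomial.C c : k[X]) • (1 ⊗ₜ X) := by
          rw [TensorProduct.smul_tmul', smul_eq_mul, mul_one, ← TensorProduct.smul_tmul,
            Polynomial.smul_eq_C_mul, mul_one]
        rw [this, map_smul]
        exact Submodule.smul_mem _ _ h
      | mem X hX =>
        obtain ⟨w, g, hw, rfl⟩ := hX
        exact ih e he w g hw
    let N : Submodule k (DeformedAlg v q κ) :=
      (LinearMap.range (ofSection κ σ s)).restrictScalars k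
    let ψ : TwistedSkewGroupAlgebra (tensorAction ρ) α →ₗ[k] DeformedAlg v q κ :=
      (proj v q κ).toLinearMap.restrictScalars k ∘ₗ TensorProduct.mk k k[X] _ 1
    -- The values at other lengths are zero so that the q-swap rule holds for all words, as
    -- `eq_invWeight_smul_insertionSort` requires.
    let F : List (Fin n) → DeformedAlg v q κ ⧸ N := fun w =>
      if w.length = d then N.mkQ (ψ (single _ α g (word v w))) else 0
    have hF : ∀ x i j y, F (x ++ i :: j :: y) = q i j • F (x ++ j :: i :: y) := by
      intro x i j y
      have hlen : (x ++ i :: j :: y).length = (x ++ j :: i :: y).length := by simp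
      simp only [F, hlen]
      split_ifs with hd
      · rw [← map_smul, ← map_smul, ← sub_eq_zero, ← map_sub, ← map_sub, Submodule.mkQ_apply,
          Submodule.Quotient.mk_eq_zero]
        have h1 : single (tensorAction ρ) α g (word v (x ++ i :: j :: y)) -
            q i j • single (tensorAction ρ) α g (word v (x ++ j :: i :: y)) =
            skewWord v ρ α x * skewRelator v q ρ α i j *
              single (tensorAction ρ) α g (word v y) := by
          rw [skewWord, skewRelator, single_one_mul_single, single_one_mul_single,
            word_mul_relator_mul_word, ← lsingle_apply, ← lsingle_apply, ← lsingle_apply, map_sub,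
            map_smul]
        have h2 : ψ (skewWord v ρ α x * skewRelator v q ρ α i j *
              single (tensorAction ρ) α g (word v y)) = (Polynomial.X : k[X]) •
            proj v q κ (1 ⊗ₜ (skewWord v ρ α x * κ i j *
              single (tensorAction ρ) α g (word v y))) := by
          have e1 : ψ (skewWord v ρ α x * skewRelator v q ρ α i j *
              single (tensorAction ρ) α g (word v y)) =
              proj v q κ (1 ⊗ₜ skewWord v ρ α x) * proj v q κ (1 ⊗ₜ skewRelator v q ρ α i j) *
                proj v q κ (1 ⊗ₜ single (tensorAction ρ) α g (word v y)) := by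
            rw [← map_mul, ← map_mul, Algebra.TensorProduct.tmul_mul_tmul,
              Algebra.TensorProduct.tmul_mul_tmul, mul_one, mul_one]
            rfl
          rw [e1, proj_rel, ← map_mul, ← map_mul, Algebra.TensorProduct.tmul_mul_tmul,
            Algebra.TensorProduct.tmul_mul_tmul, ← map_smul, TensorProduct.smul_tmul', smul_eq_mul,
            mul_one, mul_one, one_mul]
        rw [h1, h2]
        refine Submodule.smul_mem (LinearMap.range (ofSection κ σ s)) _
          (ih' (x.length + 0 + y.length) ?_ _ (mul_mem_wordDegree (mul_mem_wordDegree
            (skewWord_mem_wordDegree x) (hκ.mem i j)) (single_word_mem_wordDegree y g)))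
        rw [← hd]
        simp
      · rw [smul_zero]
    have h1 := eq_invWeight_smul_insertionSort hq hF w₀
    have hlen : (w₀.insertionSort (· ≤ ·)).length = d := by rw [List.length_insertionSort, hw₀]
    -- The section sends the class of a word to its normal ordering, so this element is an image by
    -- construction.
    have h2 : ψ (single _ α g (invWeight q w₀ • word v (w₀.insertionSort (· ≤ ·)))) ∈ N := by
      refine ⟨1 ⊗ₜ single σ α g (QuadraticAlg.proj v q (word v w₀)), ?_⟩
      rw [ofSection_tmul, skewSection_single, hs, normalOrder, wordLift_word]
      rfl
    simp only [F, hlen, hw₀, if_true] at h1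
    rw [← map_smul, ← map_smul, smul_single, Submodule.mkQ_apply, Submodule.mkQ_apply,
      (Submodule.Quotient.mk_eq_zero N).mpr h2, Submodule.Quotient.mk_eq_zero] at h1
    exact h1
  intro y
  obtain ⟨x, rfl⟩ := RingQuot.mkAlgHom_surjective k[X] _ y
  change proj v q κ x ∈ LinearMap.range (ofSection κ σ s)
  have htop : ∀ X : TwistedSkewGroupAlgebra (tensorAction ρ) α,
      proj v q κ (1 ⊗ₜ X) ∈ (LinearMap.range (ofSection κ σ s)).restrictScalars k := by
    intro X
    let N : Submodule k (DeformedAlg v q κ) :=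
      (LinearMap.range (ofSection κ σ s)).restrictScalars k
    let ψ : TwistedSkewGroupAlgebra (tensorAction ρ) α →ₗ[k] DeformedAlg v q κ :=
      (proj v q κ).toLinearMap.restrictScalars k ∘ₗ TensorProduct.mk k k[X] _ 1
    have h : N.mkQ ∘ₗ ψ = 0 := by
      refine linearMap_ext_single_word (v := v) fun g w => ?_
      rw [LinearMap.comp_apply, Submodule.mkQ_apply, LinearMap.zero_apply,
        Submodule.Quotient.mk_eq_zero]
      exact hword _ w g rfl
    have := LinearMap.congr_fun h X
    rwa [LinearMap.comp_apply, Submodule.mkQ_apply, LinearMap.zero_apply,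
      Submodule.Quotient.mk_eq_zero] at this
  induction x using TensorProduct.induction_on with
  | zero => simp
  | add x y hx hy =>
    rw [map_add]
    exact Submodule.add_mem _ hx hy
  | tmul p X =>
    have : p ⊗ₜ[k] X = p • ((1 : k[X]) ⊗ₜ[k] X) := by
      rw [TensorProduct.smul_tmul', smul_eq_mul, mul_one]
    rw [this, map_smul]
    exact Submodule.smul_mem _ _ (htop X)

end Deformed

/-! ### Comparison of the first-order term with the cocycle -/

section Lifting

variable {k G V : Type*} [Field k] [Group G] [AddCommGroup V] [Module k V] {n : ℕ}
  {v : Module.Basis (Fin n) k V} {q : Fin n → Fin n → k} {ρ : Representation k G V}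
  {α : NormalizedTwoCocycle k G} {σ : G →* (QuadraticAlg v q ≃ₐ[k] QuadraticAlg v q)}
  {μ : TwistedSkewGroupAlgebra σ α →ₗ[k] TwistedSkewGroupAlgebra σ α →ₗ[k]
    TwistedSkewGroupAlgebra σ α}

open TwistedSkewGroupAlgebra

/-- Equivariance and the hexagon identity hold in R. Their lifts have degree 0 and 1, where the
projection from T(V) #_α G is injective. -/
theorem isRelatorDeformation_relatorValue (hq : IsQuantumSystem q) (h2 : (2 : k) ≠ 0)
    (hσ : QuadraticAlg.Extends ρ σ) (hμ : IsHochschildTwoCocycle μ)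
    (hc : HasDegreeNegTwo (degreePart σ α (QuadraticAlg.degreePart v q)) μ)
    {s : QuadraticAlg v q →ₗ[k] TensorAlgebra k V}
    (hs : ∀ a, QuadraticAlg.proj v q (s a) = a)
    (hs' : ∀ x, s (QuadraticAlg.proj v q x) = normalOrder v q x) :
    IsRelatorDeformation v q ρ α fun i j => skewSection ρ α σ s (relatorValue μ i j) := by
  have hmem : ∀ i j, skewSection ρ α σ s (relatorValue μ i j) ∈ wordDegree v ρ α 0 :=
    fun i j => skewSection_mem_wordDegree_zero hs' (relatorValue_mem hc i j)
  have hword : ∀ i, skewProj hσ α (skewWord v ρ α [i]) = skewVec σ α (v i) := by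
    intro i
    rw [skewWord, skewProj_single, word_cons, word_nil, mul_one]
    rfl
  have hleft : ∀ {X Y} {d : ℕ}, X ∈ wordDegree v ρ α 0 → Y ∈ wordDegree v ρ α d →
      X * Y ∈ wordDegree v ρ α d := by
    intro X Y d hX hY
    have := mul_mem_wordDegree hX hY
    rwa [zero_add] at this
  have hright : ∀ {X Y} {d : ℕ}, X ∈ wordDegree v ρ α d → Y ∈ wordDegree v ρ α 0 →
      X * Y ∈ wordDegree v ρ α d := by
    intro X Y d hX hY
    have := mul_mem_wordDegree hX hY
    rwa [add_zero] at this
  have hwordmem : ∀ i, skewWord v ρ α [i] ∈ wordDegree v ρ α 1 := fun i =>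
    skewWord_mem_wordDegree [i]
  refine ⟨hmem, fun i j => ?_, fun i => ?_, fun g i j => ?_, fun i j l => ?_⟩
  · rw [relatorValue_swap hq i j, map_neg, map_smul]
  · rw [relatorValue_self hq, map_zero]
  · refine ⟨fun a b => 2⁻¹ * relatorCoeff v q ρ g i j a b, single_mul_relator hq h2 hσ g i j, ?_⟩
    have hsum : ∑ a, ∑ b, (2⁻¹ * relatorCoeff v q ρ g i j a b) •
        skewSection ρ α σ s (relatorValue μ a b) ∈ wordDegree v ρ α 0 :=
      Submodule.sum_mem _ fun a _ => Submodule.sum_mem _ fun b _ =>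
        Submodule.smul_mem _ _ (hmem a b)
    refine eq_of_skewProj_eq hq hσ zero_le_one
      (hleft (single_one_mem_wordDegree g) (hmem i j))
      (hleft hsum (single_one_mem_wordDegree g)) ?_
    simp only [map_mul, map_sum, map_smul, skewProj_skewSection hσ hs, skewProj_single, map_one]
    exact single_mul_relatorValue hq h2 hσ hμ hc g i j
  · have h1 : ∀ i j l, skewSection ρ α σ s (relatorValue μ i j) * skewWord v ρ α [l] ∈
        wordDegree v ρ α 1 := fun i j l => hleft (hmem i j) (hwordmem l)
    have h1' : ∀ i j l, skewWord v ρ α [l] * skewSection ρ α σ s (relatorValue μ i j) ∈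
        wordDegree v ρ α 1 := fun i j l => hright (hwordmem l) (hmem i j)
    refine eq_of_skewProj_eq hq hσ le_rfl
      (Submodule.add_mem _ (Submodule.add_mem _ (h1 _ _ _) (Submodule.smul_mem _ _ (h1' _ _ _)))
        (Submodule.smul_mem _ _ (h1 _ _ _)))
      (Submodule.add_mem _ (Submodule.add_mem _ (h1' _ _ _) (Submodule.smul_mem _ _ (h1 _ _ _)))
        (Submodule.smul_mem _ _ (h1' _ _ _))) ?_
    simp only [map_mul, map_add, map_smul, skewProj_skewSection hσ hs, hword]
    exact relatorValue_hexagon hμ i j l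

theorem squareZeroIncl_one_mul_firstOrderRep (hσ : QuadraticAlg.Extends ρ σ)
    (hμ : IsHochschildTwoCocycle μ)
    (hc : HasDegreeNegTwo (degreePart σ α (QuadraticAlg.degreePart v q)) μ)
    (X : TwistedSkewGroupAlgebra (tensorAction ρ) α) :
    squareZeroIncl k 1 * firstOrderRep hσ hμ hc X = squareZeroIncl k (skewProj hσ α X) := by
  obtain ⟨z, hz⟩ := firstOrderRep_eq hσ hμ hc X
  rw [hz, mul_add, squareZeroIncl_mul_squareZeroMul, squareZeroIncl_mul_squareZeroIncl, one_mul,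
    add_zero]

theorem firstOrderRep_mul_squareZeroIncl_one (hσ : QuadraticAlg.Extends ρ σ)
    (hμ : IsHochschildTwoCocycle μ)
    (hc : HasDegreeNegTwo (degreePart σ α (QuadraticAlg.degreePart v q)) μ)
    (X : TwistedSkewGroupAlgebra (tensorAction ρ) α) :
    firstOrderRep hσ hμ hc X * squareZeroIncl k 1 = squareZeroIncl k (skewProj hσ α X) := by
  obtain ⟨z, hz⟩ := firstOrderRep_eq hσ hμ hc X
  rw [hz, add_mul, squareZeroMul_mul_squareZeroIncl, squareZeroIncl_mul_squareZeroIncl, mul_one,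
    add_zero]

/-- The action of `(T(V) #_α G)[ħ]` on the square-zero extension of `S_q(V) #_α G` given by `μ`. -/
def firstOrderRepHbar (hσ : QuadraticAlg.Extends ρ σ) (hμ : IsHochschildTwoCocycle μ)
    (hc : HasDegreeNegTwo (degreePart σ α (QuadraticAlg.degreePart v q)) μ) :
    k[X] ⊗[k] TwistedSkewGroupAlgebra (tensorAction ρ) α →ₐ[k]
      Module.End k (TwistedSkewGroupAlgebra σ α × TwistedSkewGroupAlgebra σ α) :=
  Algebra.TensorProduct.lift (Polynomial.aeval (squareZeroIncl k 1)) (firstOrderRep hσ hμ hc)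
    fun p X => by
      have h : Commute (squareZeroIncl k 1) (firstOrderRep hσ hμ hc X) := by
        rw [Commute, SemiconjBy, squareZeroIncl_one_mul_firstOrderRep,
          firstOrderRep_mul_squareZeroIncl_one]
      induction p using Polynomial.induction_on' with
      | add p p' hp hp' => rw [map_add]; exact hp.add_left hp'
      | monomial m c =>
        rw [Polynomial.aeval_monomial]
        exact Commute.mul_left (Algebra.commutes c _) (h.pow_left m)

theorem firstOrderRepHbar_tmul (hσ : QuadraticAlg.Extends ρ σ) (hμ : IsHochschildTwoCocycle μ)
    (hc : HasDegreeNegTwo (degreePart σ α (QuadraticAlg.degreePart v q)) μ) (p : k[X])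
    (X : TwistedSkewGroupAlgebra (tensorAction ρ) α) :
    firstOrderRepHbar hσ hμ hc (p ⊗ₜ X) =
      p.coeff 0 • firstOrderRep hσ hμ hc X + p.coeff 1 • squareZeroIncl k (skewProj hσ α X) := by
  have h : Polynomial.aeval (squareZeroIncl k (1 : TwistedSkewGroupAlgebra σ α)) p =
      p.coeff 0 • 1 + p.coeff 1 • squareZeroIncl k 1 := by
    induction p using Polynomial.induction_on' with
    | add p p' hp hp' =>
      rw [map_add, hp, hp', Polynomial.coeff_add, Polynomial.coeff_add, add_smul, add_smul]
      abel
    | monomial m c =>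
      rw [Polynomial.aeval_monomial, Algebra.algebraMap_eq_smul_one]
      rcases m with _ | _ | m
      · simp
      · simp [Polynomial.coeff_monomial]
      · rw [pow_succ, pow_succ, mul_assoc (squareZeroIncl k 1 ^ m),
          squareZeroIncl_mul_squareZeroIncl]
        simp [Polynomial.coeff_monomial]
  rw [firstOrderRepHbar, Algebra.TensorProduct.lift_tmul, h, add_mul, smul_mul_assoc, one_mul,
    smul_mul_assoc, squareZeroIncl_one_mul_firstOrderRep]

/-- Two operators which come from the square-zero extension are equal only if they come from the
same element. -/
theorem squareZeroMul_add_squareZeroIncl_injective (hμ : IsHochschildTwoCocycle μ)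
    (h11 : μ 1 1 = 0) {a b z w : TwistedSkewGroupAlgebra σ α}
    (h : squareZeroMul μ a + squareZeroIncl k z = squareZeroMul μ b + squareZeroIncl k w) :
    a = b ∧ z = w := by
  have h' := LinearMap.congr_fun h (1, 0)
  simpa [squareZeroMul_apply, squareZeroIncl_apply, hμ.one_right h11] using h'

/-- The product is transported from the deformed algebra along the PBW isomorphism, which gives
associativity and a unit. The action on the square-zero extension then determines the coefficients
of ħ^0 and ħ^1. -/
theorem exists_deformation (hq : IsQuantumSystem q) (h2 : (2 : k) ≠ 0)
    (hσ : QuadraticAlg.Extends ρ σ) (hμ : IsHochschildTwoCocycle μ)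
    (hc : HasDegreeNegTwo (degreePart σ α (QuadraticAlg.degreePart v q)) μ) :
    ∃ D : PolynomialDeformation k (TwistedSkewGroupAlgebra σ α),
      HochschildCohomologous μ (D.term 1) := by
  obtain ⟨s, hs, hs'⟩ := exists_section v hq
  set κ := fun i j => skewSection ρ α σ s (relatorValue μ i j) with hκdef
  have hκ : IsRelatorDeformation v q ρ α κ :=
    isRelatorDeformation_relatorValue hq h2 hσ hμ hc hs hs'
  have h11 : μ 1 1 = 0 := hc.single_single 1 1
  let Φ : k[X] ⊗[k] TwistedSkewGroupAlgebra σ α ≃ₗ[k[X]] DeformedAlg v q κ :=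
    LinearEquiv.ofBijective (DeformedAlg.ofSection κ σ s)
      ⟨DeformedAlg.ofSection_injective hq hσ hκ hs, DeformedAlg.ofSection_surjective hq hκ hs'⟩
  let mul := ((LinearMap.mul k[X] (DeformedAlg v q κ)).compl₁₂ Φ.toLinearMap Φ.toLinearMap).compr₂
    Φ.symm.toLinearMap
  have hmul : ∀ x y, Φ (mul x y) = Φ x * Φ y := fun x y => Φ.apply_symm_apply _
  -- A relator acts as ε κ_ij, and so does ħ κ_ij, since ħ acts as ε.
  have hrel : ∀ ⦃x y⦄, DeformedRel (v := v) q κ x y →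
      (firstOrderRepHbar hσ hμ hc).toRingHom x = (firstOrderRepHbar hσ hμ hc).toRingHom y := by
    rintro _ _ ⟨i, j⟩
    change firstOrderRepHbar hσ hμ hc _ = firstOrderRepHbar hσ hμ hc _
    rw [firstOrderRepHbar_tmul, firstOrderRepHbar_tmul, skewRelator, firstOrderRep_relator,
      skewProj_single, QuadraticAlg.proj_relator, single_zero, map_zero,
      skewProj_skewSection hσ hs]
    simp
  let Λ : DeformedAlg v q κ →+*
      Module.End k (TwistedSkewGroupAlgebra σ α × TwistedSkewGroupAlgebra σ α) :=
    RingQuot.lift ⟨(firstOrderRepHbar hσ hμ hc).toRingHom, hrel⟩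
  have hΛ : ∀ x, Λ (DeformedAlg.proj v q κ x) = firstOrderRepHbar hσ hμ hc x := by
    intro x
    have h1 : DeformedAlg.proj v q κ x = RingQuot.mkRingHom (DeformedRel (v := v) q κ) x := by
      rw [← RingQuot.mkAlgHom_coe k[X]]
      rfl
    rw [h1]
    exact RingQuot.lift_mkRingHom_apply _ hrel x
  -- The ε-part of the action of the ordered lift, read off at (1, 0). It measures how far that lift
  -- is from `squareZeroMul μ`.
  let θ : TwistedSkewGroupAlgebra σ α →ₗ[k] TwistedSkewGroupAlgebra σ α :=
    LinearMap.snd k _ _ ∘ₗ (LinearMap.applyₗ (1, 0)) ∘ₗ (firstOrderRep hσ hμ hc).toLinearMap ∘ₗ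
      skewSection ρ α σ s
  have hθ : ∀ a, firstOrderRep hσ hμ hc (skewSection ρ α σ s a) =
      squareZeroMul μ a + squareZeroIncl k (θ a) := by
    intro a
    obtain ⟨z, hz⟩ := firstOrderRep_eq hσ hμ hc (skewSection ρ α σ s a)
    rw [skewProj_skewSection hσ hs] at hz
    have : θ a = z := by
      change (firstOrderRep hσ hμ hc (skewSection ρ α σ s a) (1, 0)).2 = z
      rw [hz]
      simp [squareZeroMul_apply, squareZeroIncl_apply, hμ.one_right h11]
    rw [hz, this]
  -- As ε² = 0, the action sees only the coefficients of ħ^0 and ħ^1.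
  have hΛΦ : ∀ m, Λ (Φ m) = squareZeroMul μ (hbarCoeff k _ 0 m) +
      squareZeroIncl k (hbarCoeff k _ 1 m + θ (hbarCoeff k _ 0 m)) := by
    intro m
    induction m using TensorProduct.induction_on with
    | zero => simp
    | add m m' h h' =>
      simp only [map_add] at h h' ⊢
      rw [h, h']
      abel
    | tmul p a =>
      change Λ (DeformedAlg.proj v q κ (p ⊗ₜ skewSection ρ α σ s a)) = _
      rw [hΛ, firstOrderRepHbar_tmul, hθ, skewProj_skewSection hσ hs, hbarCoeff_tmul,
        hbarCoeff_tmul, map_smul, map_add, map_smul, map_smul, map_smul, smul_add]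
      abel
  have hcoeff : ∀ x y, hbarCoeff k _ 0 (mul x y) = hbarCoeff k _ 0 x * hbarCoeff k _ 0 y ∧
      hbarCoeff k _ 1 (mul x y) + θ (hbarCoeff k _ 0 (mul x y)) =
        μ (hbarCoeff k _ 0 x) (hbarCoeff k _ 0 y) +
          hbarCoeff k _ 0 x * (hbarCoeff k _ 1 y + θ (hbarCoeff k _ 0 y)) +
          (hbarCoeff k _ 1 x + θ (hbarCoeff k _ 0 x)) * hbarCoeff k _ 0 y := by
    intro x y
    have h := congrArg Λ (hmul x y)
    rw [map_mul, hΛΦ, hΛΦ, hΛΦ, squareZero_mul_aux hμ] at h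
    exact squareZeroMul_add_squareZeroIncl_injective hμ h11 h
  let D : PolynomialDeformation k (TwistedSkewGroupAlgebra σ α) :=
    { mul := mul
      mul_assoc := fun x y z => Φ.injective (by rw [hmul, hmul, hmul, hmul, mul_assoc])
      exists_one := ⟨Φ.symm 1, fun x =>
        ⟨Φ.injective (by rw [hmul, Φ.apply_symm_apply, one_mul]),
          Φ.injective (by rw [hmul, Φ.apply_symm_apply, mul_one])⟩⟩
      reduction := fun x y => (hcoeff x y).1 }
  -- For a, b in R the ε-part reads μ_1(a, b) + θ(ab) = μ(a, b) + aθ(b) + θ(a)b, which gives the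
  -- sign of the cochain.
  refine ⟨D, -θ, fun a b => ?_⟩
  have h := hcoeff (1 ⊗ₜ a) (1 ⊗ₜ b)
  have hterm : D.term 1 a b = hbarCoeff k _ 1 (mul (1 ⊗ₜ a) (1 ⊗ₜ b)) := rfl
  have e0 : ∀ a : TwistedSkewGroupAlgebra σ α, hbarCoeff k _ 0 (1 ⊗ₜ[k] a) = a := fun a => by
    rw [hbarCoeff_one_tmul, if_pos rfl]
  have e1 : ∀ a : TwistedSkewGroupAlgebra σ α, hbarCoeff k _ 1 (1 ⊗ₜ[k] a) = 0 := fun a => by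
    rw [hbarCoeff_one_tmul, if_neg one_ne_zero]
  rw [e0, e0, e1, e1, zero_add, zero_add] at h
  have h' := h.2
  rw [h.1] at h'
  rw [hterm]
  simp only [LinearMap.neg_apply, mul_neg, neg_mul]
  linear_combination (norm := abel) -h'

end Lifting
end

theorem mainTheorem6 {G V : Type*} [Group G] [Finite G] [AddCommGroup V] [Module ℂ V] {n : ℕ}
    (v : Module.Basis (Fin n) ℂ V) (ρ : Representation ℂ G V)
    (q : Fin n → Fin n → ℂ) (hq_ne : ∀ i j, q i j ≠ 0) (hq_diag : ∀ i, q i i = 1)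
    (hq_inv : ∀ i j, q j i = (q i j)⁻¹)
    (α : NormalizedTwoCocycle ℂ G)
    (σ : G →* (QuantumSymmetricAlgebra v q ≃ₐ[ℂ] QuantumSymmetricAlgebra v q))
    (hσ : QuadraticAlg.Extends ρ σ)
    (hext : ∃ τ : G →* (QuantumExteriorAlgebra v q ≃ₐ[ℂ] QuantumExteriorAlgebra v q),
      QuadraticAlg.Extends ρ τ)
    (μ : TwistedSkewGroupAlgebra σ α →ₗ[ℂ] TwistedSkewGroupAlgebra σ α →ₗ[ℂ]
      TwistedSkewGroupAlgebra σ α)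
    (hμ : IsHochschildTwoCocycle μ)
    (hμ_const : HasDegreeNegTwo
      (TwistedSkewGroupAlgebra.degreePart σ α (QuadraticAlg.degreePart v q)) μ) :
    ∃ D : PolynomialDeformation ℂ (TwistedSkewGroupAlgebra σ α),
      HochschildCohomologous μ (D.term 1) :=
  exists_deformation ⟨hq_ne, hq_diag, hq_inv⟩ two_ne_zero hσ hμ hμ_const
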